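/- **Setting.** An offline AdCell instance has $m$ advertisers with budgets $B_i>0$, $n$ queries, $s$ customers, and bids $b_{i,j}\ge 0$. Each query $j$ belongs to one customer; $S_k$ is the set of queries of customer $k$, and $c_k\in\mathbb{N}$ is the capacity of $k$. It is known which queries arrive: $I_j\in\{0,1\}$. An allocation $X\in\{0,1\}^{m\times n}$ is *feasible* if it satisfies the assignment constraints $\sum_i X_{ij}\le I_j$ for all $j$ and the capacity constraints $\sum_{j\in S_k}\sum_i X_{ij}\le c_k$ for all $k$. Its revenue is $\sum_i\min\bigl(\sum_j X_{ij}b_{i,j},B_i\bigr)$. The LP relaxation maximizes $\sum_{i,j}x_{ij}b_{i,j}$ over $x\in[0,1]^{m\times n}$ subject to the assignment constraints, the capacity constraints and the budget constraints $\sum_j x_{ij}b_{i,j}\le B_i$ for all $i$; $\mathsf{LPOpt}$ is its optimal value. Put $\rho=\max_i b_{i,\max}/B_i$ with $b_{i,\max}=\max_j b_{i,j}$. **Iterative rounding.** Start from an optimal LP solution $y$. In the current $y$, call the variable of the edge $(i,j)$ *fractional* if $0<y_{ij}<1$; the other variables are rounded and stay fixed. The *kept constraints* at $y$ are $x\in[0,1]^{m\times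 n}$, all assignment and capacity constraints, and the budget constraints of the advertisers with at least two fractional edges at $y$. A *direction* is a nonzero $r$ supported on the fractional edges; a *maximal step* along $r$ is the largest $\alpha>0$ for which $y+\alpha r$ satisfies the kept constraints. While some variable is fractional, make one of the following moves. * *Cycle breaking* (only if the bipartite graph of fractional edges is not a forest): replace $y$ by $y+\beta z$, a maximal step along a direction $z$ that changes the payment $\sum_j y_{ij}b_{i,j}$ of no advertiser and the total $\sum_i y_{ij}$ of at most one query, which does not increase. * *Rand-Move* (only if that graph is a forest): for a direction $r$ with maximal steps $\alpha>0$ along $r$ and $\beta>0$ along $-r$, replace $y$ by $y+\alpha r$ with probability $\frac{\beta}{\alpha+\beta}$ and by $y-\beta r$ with probability $\frac{\alpha}{\alpha+\beta}$. * *Lowering a tight customer* (only if that graph is a forest): replace $y$ by $y+\beta z$, a maximal step along a direction $z$ that changes the payment of no advertiser, the total of no query with tight assignment constraint, and the load $\sum_{j\in S_k}\sum_i y_{ij}$ of at most one customer, whose capacity constraint is tight and whose load does not increase. The choice among the possible moves is arbitrary and may depend on the past. **Theorem.** There is an absolute constant $C$ such that the following holds for all $m,n,s$ and all instances. 1. From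 any optimal LP solution, every execution makes at most $C(m+n+s+1)^C$ moves, and a move is available as long as some variable is fractional. The final allocation always satisfies all assignment and capacity constraints, and its expected revenue is at least $$\frac{4-\rho}{4}\,\mathsf{LPOpt}.$$ In particular it is at least $\frac34\mathsf{LPOpt}$ if $b_{i,j}\le B_i$ for all $i,j$, and at least $\frac{4-\epsilon}{4}\mathsf{LPOpt}$ if $b_{i,j}\le\epsilon B_i$ for all $i,j$. 2. $\mathsf{LPOpt}$ is at least the revenue of every feasible allocation. Without any assumption on the bids, run the rounding on the instance with bids $\min(b_{i,j},B_i)$: the resulting allocation is feasible, and its expected revenue (for the original bids) is at least $\frac34$ of the LP optimum of the truncated instance and at least $\frac34$ of the maximum revenue of a feasible allocation of the original instance. 3. The rounding takes polynomial time, given an optimal LP solution: for all $m,n,s$ there is a randomized algebraic computation tree (arithmetic operations and comparisons of real numbers and tosses of coins with a computed bias, each at unit cost) of depth at most $C(m+n+s+1)^C$ which, on input any instance and any optimal solution of its LP, outputs an allocation distributed as in some execution of the rounding. -/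

import Mathlib

noncomputable section

/-- An offline instance: `m` advertisers, `n` queries, `s` customers. Query `j` belongs to
customer `customer j`, and `arrives` is the (known) set of queries that arrive. -/
structure AdCell (m n s : ℕ) where
  budget : Fin m → ℝ
  bid : Fin m → Fin n → ℝ
  customer : Fin n → Fin s
  capacity : Fin s → ℕ
  arrives : Finset (Fin n)
  budget_pos : ∀ i, 0 < budget i
  bid_nonneg : ∀ i j, 0 ≤ bid i j

/-- A fractional solution. -/
abbrev Frac (m n : ℕ) : Type := Fin m → Fin n → ℝ

/-- An integral allocation: `X i j` says that the ad of advertiser `i` is shown on query `j`. -/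
abbrev Alloc (m n : ℕ) : Type := Fin m → Fin n → Bool

/-- The 0/1 vector of an integral allocation. -/
def Alloc.toFrac {m n : ℕ} (X : Alloc m n) : Frac m n := fun i j => if X i j then 1 else 0

/-- The expectation of a real function under a probability mass function on a finite type. -/
def PMF.expect {α : Type*} [Fintype α] (D : PMF α) (f : α → ℝ) : ℝ :=
  ∑ a, (D a).toReal * f a

/-- A coin that shows `true` with probability `p`, for `p ∈ [0,1]` (other `p` are clamped). -/
def realCoin (p : ℝ) : PMF Bool :=
  PMF.ofFintype
    (fun b => cond b (min (ENNReal.ofReal p) 1) (1 - min (ENNReal.ofReal p) 1))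
    (by simp)

/-- The law `D₁` with probability `p` and the law `D₂` with probability `1 - p`. -/
def PMF.mix {α : Type*} (p : ℝ) (D₁ D₂ : PMF α) : PMF α :=
  (realCoin p).bind fun h => if h then D₁ else D₂

namespace AdCell

variable {m n s : ℕ} (I : AdCell m n s)

/-! ### The integer program and its linear relaxation -/

/-- The indicator that query `j` arrives. -/
def arrival (j : Fin n) : ℝ := if j ∈ I.arrives then 1 else 0

/-- The total (fractional) assignment of query `j`. -/
def queryLoad (x : Frac m n) (j : Fin n) : ℝ := ∑ i, x i j

/-- The total (fractional) number of ads sent to customer `k`. -/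
def customerLoad (x : Frac m n) (k : Fin s) : ℝ :=
  ∑ j with I.customer j = k, queryLoad x j

/-- The sum of the bids of advertiser `i` on what is assigned to it, without the budget cap. -/
def payment (x : Frac m n) (i : Fin m) : ℝ := ∑ j, x i j * I.bid i j

/-- The assignment constraints. -/
def Assign (x : Frac m n) : Prop := ∀ j, queryLoad x j ≤ I.arrival j

/-- The capacity constraints. -/
def Capacity (x : Frac m n) : Prop := ∀ k, I.customerLoad x k ≤ I.capacity k

/-- All entries lie in `[0,1]`. -/
def Box (x : Frac m n) : Prop := ∀ i j, 0 ≤ x i j ∧ x i j ≤ 1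

/-- Feasible solutions of the linear program. -/
def LPFeasible (x : Frac m n) : Prop :=
  Box x ∧ I.Assign x ∧ I.Capacity x ∧ ∀ i, I.payment x i ≤ I.budget i

/-- The objective of the linear program. -/
def lpValue (x : Frac m n) : ℝ := ∑ i, I.payment x i

/-- The optimal value of the linear program. -/
def lpOpt : ℝ := sSup (I.lpValue '' {x | I.LPFeasible x})

/-- Optimal solutions of the linear program. -/
def IsLPOptimal (y : Frac m n) : Prop :=
  I.LPFeasible y ∧ ∀ x, I.LPFeasible x → I.lpValue x ≤ I.lpValue y

/-- Feasible allocations of the integer program: assignment and capacity constraints. -/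
def Feasible (X : Alloc m n) : Prop := I.Assign X.toFrac ∧ I.Capacity X.toFrac

/-- The revenue of an allocation: every advertiser pays at most its budget. -/
def revenue (X : Alloc m n) : ℝ := ∑ i, min (I.payment X.toFrac i) (I.budget i)

/-- `max_i max_j (bid i j / budget i)`. -/
def maxBidRatio : ℝ := ⨆ i, ⨆ j, I.bid i j / I.budget i

/-- The same instance with every bid cut down to the budget of its advertiser. -/
def truncate : AdCell m n s where
  budget := I.budget
  bid i j := min (I.bid i j) (I.budget i)
  customer := I.customer
  capacity := I.capacity
  arrives := I.arrives
  budget_pos := I.budget_pos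
  bid_nonneg i j := le_min (I.bid_nonneg i j) (I.budget_pos i).le

/-! ### The iterative rounding -/

/-- The edge `(i, j)` is fractional: its variable is not rounded yet. -/
def IsFrac (y : Frac m n) (i : Fin m) (j : Fin n) : Prop := 0 < y i j ∧ y i j < 1

/-- All variables are rounded. -/
def Rounded (y : Frac m n) : Prop := ∀ i j, y i j = 0 ∨ y i j = 1

/-- The bipartite graph of the fractional edges between advertisers and queries. -/
def fracGraph (y : Frac m n) : SimpleGraph (Fin m ⊕ Fin n) :=
  SimpleGraph.fromRel fun a b => ∃ i j, a = Sum.inl i ∧ b = Sum.inr j ∧ IsFrac y i j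

/-- The degree of advertiser `i` in the graph of the fractional edges. -/
def advDegree (y : Frac m n) (i : Fin m) : ℕ := Set.ncard {j | IsFrac y i j}

/-- The system of constraints that an update of `y` has to respect: everything in the linear
program except the budgets of the advertisers with at most one fractional edge. -/
def Keeps (y x : Frac m n) : Prop :=
  Box x ∧ I.Assign x ∧ I.Capacity x ∧
    ∀ i, 2 ≤ advDegree y i → I.payment x i ≤ I.budget i

/-- A nonzero direction that changes fractional variables only. -/
def IsDirection (y r : Frac m n) : Prop := r ≠ 0 ∧ ∀ i j, r i j ≠ 0 → IsFrac y i j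

/-- From `y` one can go the distance `α > 0` along `r`, and no further, within the system of
constraints: at `y + α r` a variable gets rounded or a constraint becomes tight. -/
def MaxStep (y r : Frac m n) (α : ℝ) : Prop :=
  0 < α ∧ I.Keeps y (y + α • r) ∧ ∀ α', α < α' → ¬ I.Keeps y (y + α' • r)

/-- One iteration of the rounding, from `y` to a random solution with the given law. -/
inductive Move (y : Frac m n) : PMF (Frac m n) → Prop
  /-- As long as the fractional edges do not form a forest: a deterministic update that keeps
  the payments of all advertisers and all query loads but one, which does not grow. -/
  | breakCycle (z : Frac m n) (β : ℝ) (j₀ : Fin n) :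
      ¬ (fracGraph y).IsAcyclic → IsDirection y z → (∀ i, I.payment z i = 0) →
      (∀ j, j ≠ j₀ → queryLoad z j = 0) → queryLoad z j₀ ≤ 0 → I.MaxStep y z β →
      Move y (PMF.pure (y + β • z))
  /-- Rand-Move on a forest: `y + α r` with probability `β / (α + β)`, otherwise `y - β r`. -/
  | randMove (r : Frac m n) (α β : ℝ) :
      (fracGraph y).IsAcyclic → IsDirection y r → I.MaxStep y r α → I.MaxStep y (-r) β →
      Move y (PMF.mix (β / (α + β)) (PMF.pure (y + α • r)) (PMF.pure (y - β • r)))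
  /-- On a forest, along a (combined) path between two queries of one customer `k₀` whose
  capacity is tight: a deterministic update that keeps the payments of all advertisers, the loads
  of the queries with tight assignment constraint, and the loads of all customers but `k₀`, whose
  load does not grow. -/
  | lowerTight (z : Frac m n) (β : ℝ) (k₀ : Fin s) :
      (fracGraph y).IsAcyclic → IsDirection y z → (∀ i, I.payment z i = 0) →
      (∀ j, queryLoad y j = I.arrival j → queryLoad z j = 0) →
      I.customerLoad y k₀ = I.capacity k₀ →
      (∀ k, k ≠ k₀ → I.customerLoad z k = 0) → I.customerLoad z k₀ ≤ 0 → I.MaxStep y z β →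
      Move y (PMF.pure (y + β • z))

/-- `y'` is a possible outcome of one iteration from `y`. -/
def Step (y y' : Frac m n) : Prop := ∃ μ, I.Move y μ ∧ y' ∈ μ.support

/-- `D` is the law of the allocation found by the iterative rounding started at `y`, for some way
of choosing, depending on all that happened so far, the next move. -/
inductive Rounds : Frac m n → PMF (Alloc m n) → Prop
  | done (X : Alloc m n) : Rounds X.toFrac (PMF.pure X)
  | move (y : Frac m n) (μ : PMF (Frac m n)) (K : Frac m n → PMF (Alloc m n)) :
      I.Move y μ → (∀ y' ∈ μ.support, Rounds y' (K y')) → Rounds y (μ.bind K)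

end AdCell

/-! ### The machine model: randomized algebraic computation trees -/

/-- The four arithmetic operations. -/
inductive ArithOp
  | add | sub | mul | div

/-- The value of an arithmetic operation. -/
def ArithOp.eval : ArithOp → ℝ → ℝ → ℝ
  | add, a, b => a + b
  | sub, a, b => a - b
  | mul, a, b => a * b
  | div, a, b => a / b

/-- A randomized algebraic computation tree with input registers `R`, work registers `ℕ` and
outputs in `Out`. -/
inductive CompTree (R Out : Type) : Type
  | output (o : Out) : CompTree R Out
  /-- Put the constant `1` into work register `t`. -/
  | one (t : ℕ) (next : CompTree R Out) : CompTree R Out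
  /-- Put the value of an operation on two registers into work register `t`. -/
  | arith (t : ℕ) (op : ArithOp) (a b : R ⊕ ℕ) (next : CompTree R Out) : CompTree R Out
  /-- Compare two registers. -/
  | branch (a b : R ⊕ ℕ) (le gt : CompTree R Out) : CompTree R Out
  /-- Toss a coin whose bias is the content of a register. -/
  | coin (a : R ⊕ ℕ) (heads tails : CompTree R Out) : CompTree R Out

namespace CompTree

variable {R Out : Type}

/-- The running time: the largest number of instructions on a branch. -/
def time : CompTree R Out → ℕ
  | output _ => 0
  | one _ next => next.time + 1
  | arith _ _ _ _ next => next.time + 1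
  | branch _ _ le gt => max le.time gt.time + 1
  | coin _ heads tails => max heads.time tails.time + 1

/-- The law of the output, from given contents `ρ` of the input registers and `w` of the work
registers. -/
def runFrom (ρ : R → ℝ) : CompTree R Out → (ℕ → ℝ) → PMF Out
  | output o, _ => PMF.pure o
  | one t next, w => next.runFrom ρ (Function.update w t 1)
  | arith t op a b next, w =>
      next.runFrom ρ (Function.update w t (op.eval (Sum.elim ρ w a) (Sum.elim ρ w b)))
  | branch a b le gt, w =>
      if Sum.elim ρ w a ≤ Sum.elim ρ w b then le.runFrom ρ w else gt.runFrom ρ w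
  | coin a heads tails, w =>
      PMF.mix (Sum.elim ρ w a) (heads.runFrom ρ w) (tails.runFrom ρ w)

/-- The law of the output on a given input, with all work registers `0` at the start. -/
def run (T : CompTree R Out) (input : R → ℝ) : PMF Out := T.runFrom input fun _ => 0

end CompTree

/-- The names of the numbers that describe an instance together with a fractional solution. -/
inductive InputReg (m n s : ℕ) : Type
  | budget (i : Fin m)
  | bid (i : Fin m) (j : Fin n)
  | customer (j : Fin n) (k : Fin s)
  | capacity (k : Fin s)
  | arrival (j : Fin n)
  | sol (i : Fin m) (j : Fin n)

/-- The numbers that describe an instance together with a fractional solution. -/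
def AdCell.input {m n s : ℕ} (I : AdCell m n s) (y : Frac m n) : InputReg m n s → ℝ
  | .budget i => I.budget i
  | .bid i j => I.bid i j
  | .customer j k => if I.customer j = k then 1 else 0
  | .capacity k => I.capacity k
  | .arrival j => I.arrival j
  | .sol i j => y i j

end

/-!
Revenue. As long as an advertiser has two fractional edges, its budget constraint is kept and its
expected payment does not change. So consider an advertiser within its budget `B` that has a single
fractional edge, of value `x` and bid `b`, and whose other edges pay `p`, so that `p + x b ≤ B`. The
other edges stay fixed and `x` ends as `1` with probability `x`, so the expected loss is
`x (p + b - B)` if this is positive, which by AM-GM is at most `b / (4 B)` times the payment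
`p + x b`.

Number of moves. A maximal step rounds a variable or makes a kept constraint tight, so the numbers
of fractional edges and of constraints with slack decrease lexicographically.

Existence of moves. The directions of a move are the solutions of homogeneous linear equations in
the fractional variables. On a cycle of fractional edges, and on a forest by counting endpoints,
there are fewer equations than variables.

Computation. Comparisons determine the combinatorial pattern of the current solution, and with it
the equations; Gaussian elimination yields a direction and a ratio test the maximal step.
-/

/-! ### Maximal steps in a system of linear inequalities -/

theorem exists_eq_of_maximal_forall_mul_le {ι : Type*} [Finite ι] {a b : ι → ℝ} {α : ℝ}
    (hle : ∀ c, α * a c ≤ b c) (hmax : ∀ α', α < α' → ¬ ∀ c, α' * a c ≤ b c) :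
    ∃ c, 0 < a c ∧ α * a c = b c := by
  by_contra! hne
  have heventually : ∀ᶠ α' in nhdsWithin α (Set.Ioi α), ∀ c, α' * a c ≤ b c := by
    refine Filter.eventually_all.2 fun c => ?_
    rcases lt_or_ge 0 (a c) with hpos | hnonpos
    · have hlt : α * a c < b c := (hle c).lt_of_ne (hne c hpos)
      have hnhds : ∀ᶠ α' in nhds α, α' * a c < b c :=
        (continuous_mul_const (a c)).continuousAt.eventually_lt_const hlt
      exact (hnhds.filter_mono nhdsWithin_le_nhds).mono fun _ => le_of_lt
    · filter_upwards [self_mem_nhdsWithin] with α' hα'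
      exact (mul_le_mul_of_nonpos_right (le_of_lt hα') hnonpos).trans (hle c)
  obtain ⟨α', hle', hα'⟩ := (heventually.and self_mem_nhdsWithin).exists
  exact hmax α' hα' hle'

namespace AdCell

variable {m n s : ℕ} (I : AdCell m n s)

/-- The names of the linear constraints: budgets, assignments and capacities. -/
abbrev Row (m n s : ℕ) : Type := Fin m ⊕ Fin n ⊕ Fin s

/-- The left-hand side of a linear constraint. -/
def load (x : Frac m n) : Row m n s → ℝ
  | .inl i => I.payment x i
  | .inr (.inl j) => queryLoad x j
  | .inr (.inr k) => I.customerLoad x k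

/-- The right-hand side of a linear constraint. -/
def bound : Row m n s → ℝ
  | .inl i => I.budget i
  | .inr (.inl j) => I.arrival j
  | .inr (.inr k) => I.capacity k

/-- The coefficient of an edge in a linear constraint. -/
def coef : Row m n s → Fin m × Fin n → ℝ
  | .inl i, e => if e.1 = i then I.bid e.1 e.2 else 0
  | .inr (.inl j), e => if e.2 = j then 1 else 0
  | .inr (.inr k), e => if I.customer e.2 = k then 1 else 0

theorem load_eq_sum (x : Frac m n) (v : Row m n s) :
    I.load x v = ∑ e : Fin m × Fin n, I.coef v e * x e.1 e.2 := by
  rcases v with i | j | k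
  · simp only [load, coef, payment, Fintype.sum_prod_type, ite_mul, zero_mul]
    rw [Finset.sum_comm]
    simp [mul_comm]
  · simp [load, coef, queryLoad, Fintype.sum_prod_type]
  · simp only [load, coef, customerLoad, queryLoad, Fintype.sum_prod_type_right, ite_mul, zero_mul,
      one_mul, Finset.sum_filter]
    refine Finset.sum_congr rfl fun j _ => ?_
    split_ifs <;> simp

theorem load_add_smul (y r : Frac m n) (α : ℝ) (v : Row m n s) :
    I.load (y + α • r) v = I.load y v + α * I.load r v := by
  simp only [load_eq_sum, Finset.mul_sum, ← Finset.sum_add_distrib]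
  refine Finset.sum_congr rfl fun e _ => ?_
  simp only [Pi.add_apply, Pi.smul_apply, smul_eq_mul]
  ring

theorem load_neg (r : Frac m n) (v : Row m n s) : I.load (-r) v = -I.load r v := by
  simp [load_eq_sum]

theorem payment_add_smul (y r : Frac m n) (α : ℝ) (i : Fin m) :
    I.payment (y + α • r) i = I.payment y i + α * I.payment r i :=
  I.load_add_smul y r α (.inl i)

/-- The linear constraints among the kept constraints at `y`. -/
def Active (y : Frac m n) : Row m n s → Prop
  | .inl i => 2 ≤ advDegree y i
  | .inr _ => True

theorem keeps_iff (y x : Frac m n) :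
    I.Keeps y x ↔ Box x ∧ ∀ v, Active y v → I.load x v ≤ I.bound v := by
  simp only [Keeps, Sum.forall, Active, load, bound, Assign, Capacity]
  tauto

/-- The names of all inequalities of the system: the lower bounds `0` on the variables, the upper
bounds `1`, and the linear constraints. -/
abbrev Ineq (m n s : ℕ) : Type := (Fin m × Fin n) ⊕ (Fin m × Fin n) ⊕ Row m n s

/-- The rate at which the direction `r` uses up the slack of an inequality. -/
def slope (r : Frac m n) : Ineq m n s → ℝ
  | .inl e => -r e.1 e.2
  | .inr (.inl e) => r e.1 e.2
  | .inr (.inr v) => I.load r v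

/-- The slack of an inequality at `y`. -/
def slack (y : Frac m n) : Ineq m n s → ℝ
  | .inl e => y e.1 e.2
  | .inr (.inl e) => 1 - y e.1 e.2
  | .inr (.inr v) => I.bound v - I.load y v

/-- The kept constraints at `y`. -/
def ActiveIneq (y : Frac m n) : Ineq m n s → Prop
  | .inr (.inr v) => Active y v
  | _ => True

theorem keeps_add_smul_iff (y y₀ r : Frac m n) (α : ℝ) :
    I.Keeps y₀ (y + α • r) ↔ ∀ c, ActiveIneq y₀ c → α * I.slope r c ≤ I.slack y c := by
  have hlower : ∀ i j, 0 ≤ (y + α • r) i j ↔ α * -r i j ≤ y i j := fun i j => by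
    rw [mul_neg, neg_le_iff_add_nonneg]
    rfl
  have hupper : ∀ i j, (y + α • r) i j ≤ 1 ↔ α * r i j ≤ 1 - y i j := fun i j =>
    le_sub_iff_add_le'.symm
  simp only [keeps_iff, Box, Sum.forall, Prod.forall, ActiveIneq, slope, slack, load_add_smul,
    hlower, hupper, forall_and, le_sub_iff_add_le', true_implies, and_assoc]

theorem Keeps.slack_nonneg {I : AdCell m n s} {y : Frac m n} (h : I.Keeps y y) {c : Ineq m n s}
    (hc : ActiveIneq y c) : 0 ≤ I.slack y c := by
  simpa using (I.keeps_add_smul_iff y y 0 0).1 (by simpa using h) c hc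

/-- The kept constraints at `y` allow a step of positive length along `r`. -/
def Allows (y r : Frac m n) : Prop :=
  ∀ c, ActiveIneq y c → 0 < I.slope r c → 0 < I.slack y c

theorem maxStep_of_isLeast_ratio {y r : Frac m n} {α : ℝ} (hy : I.Keeps y y)
    (hr : I.Allows y r)
    (hα : IsLeast {x | ∃ c, (ActiveIneq y c ∧ 0 < I.slope r c) ∧ I.slack y c / I.slope r c = x} α) :
    I.MaxStep y r α := by
  obtain ⟨⟨c₀, ⟨hc₀, hs₀⟩, hratio⟩, hmin⟩ := hα
  have hα0 : 0 < α := hratio ▸ div_pos (hr c₀ hc₀ hs₀) hs₀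
  refine ⟨hα0, (I.keeps_add_smul_iff y y r α).2 fun c hc => ?_, fun α' hα' hk => ?_⟩
  · rcases lt_or_ge 0 (I.slope r c) with hs | hs
    · exact (le_div_iff₀ hs).1 (hmin ⟨c, ⟨hc, hs⟩, rfl⟩)
    · exact (mul_nonpos_of_nonneg_of_nonpos hα0.le hs).trans (hy.slack_nonneg hc)
  · have := (le_div_iff₀ hs₀).2 ((I.keeps_add_smul_iff y y r α').1 hk c₀ hc₀)
    linarith

theorem MaxStep.exists_tight {I : AdCell m n s} {y r : Frac m n} {α : ℝ} (h : I.MaxStep y r α) :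
    ∃ c, ActiveIneq y c ∧ 0 < I.slope r c ∧ α * I.slope r c = I.slack y c := by
  obtain ⟨-, hkeeps, hmax⟩ := h
  simp only [keeps_add_smul_iff] at hkeeps hmax
  obtain ⟨⟨c, hc⟩, hslope, htight⟩ :=
    exists_eq_of_maximal_forall_mul_le (ι := {c : Ineq m n s // ActiveIneq y c})
      (fun c => hkeeps c c.2) fun α' hα' h => hmax α' hα' fun c hc => h ⟨c, hc⟩
  exact ⟨c, hc, hslope, htight⟩

/-! ### Invariants of the rounding -/

theorem Rounded.not_isFrac {y : Frac m n} (h : Rounded y) (i : Fin m) (j : Fin n) :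
    ¬ IsFrac y i j := by
  rcases h i j with h | h <;> simp [IsFrac, h]

theorem Box.eq_zero_or_eq_one {y : Frac m n} (hy : Box y) {i : Fin m} {j : Fin n}
    (h : ¬ IsFrac y i j) : y i j = 0 ∨ y i j = 1 := by
  have := hy i j
  by_contra! hne
  exact h ⟨lt_of_le_of_ne this.1 hne.1.symm, lt_of_le_of_ne this.2 hne.2⟩

theorem IsDirection.isFrac_of_add_smul {y r : Frac m n} {α : ℝ} (hr : IsDirection y r) {i : Fin m}
    {j : Fin n} (h : IsFrac (y + α • r) i j) : IsFrac y i j := by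
  by_cases h0 : r i j = 0
  · simpa [IsFrac, h0] using h
  · exact hr.2 i j h0

theorem IsDirection.neg {y r : Frac m n} (h : IsDirection y r) : IsDirection y (-r) :=
  ⟨neg_ne_zero.2 h.1, fun i j hij => h.2 i j (by simpa using hij)⟩

theorem Active.of_imp {y y' : Frac m n} (h : ∀ i j, IsFrac y' i j → IsFrac y i j) {v : Row m n s}
    (hv : Active y' v) : Active y v := by
  rcases v with i | v
  · exact le_trans hv (Set.ncard_le_ncard (h i) (Set.toFinite _))
  · trivial

theorem Keeps.of_imp {I : AdCell m n s} {y y' x : Frac m n}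
    (h : ∀ i j, IsFrac y' i j → IsFrac y i j) (hk : I.Keeps y x) : I.Keeps y' x := by
  rw [keeps_iff] at *
  exact ⟨hk.1, fun v hv => hk.2 v (hv.of_imp h)⟩

theorem Step.exists_maxStep {I : AdCell m n s} {y y' : Frac m n} (h : I.Step y y') :
    ∃ r α, IsDirection y r ∧ I.MaxStep y r α ∧ y' = y + α • r := by
  obtain ⟨μ, hμ, hy'⟩ := h
  cases hμ with
  | breakCycle z β _ _ hz _ _ _ hβ => exact ⟨z, β, hz, hβ, by simpa using hy'⟩
  | randMove r α β _ hr hα hβ =>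
    simp only [PMF.mix, PMF.mem_support_bind_iff] at hy'
    obtain ⟨heads, -, hmem⟩ := hy'
    cases heads
    · exact ⟨-r, β, hr.neg, hβ, by simpa [sub_eq_add_neg] using hmem⟩
    · exact ⟨r, α, hr, hα, by simpa using hmem⟩
  | lowerTight z β _ _ hz _ _ _ _ _ hβ => exact ⟨z, β, hz, hβ, by simpa using hy'⟩

theorem Step.isFrac {I : AdCell m n s} {y y' : Frac m n} (h : I.Step y y') {i : Fin m} {j : Fin n}
    (hf : IsFrac y' i j) : IsFrac y i j := by
  obtain ⟨r, α, hr, -, rfl⟩ := h.exists_maxStep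
  exact hr.isFrac_of_add_smul hf

theorem Step.keeps_self {I : AdCell m n s} {y y' : Frac m n} (h : I.Step y y') :
    I.Keeps y' y' := by
  obtain ⟨r, α, hr, hα, rfl⟩ := h.exists_maxStep
  exact hα.2.1.of_imp fun _ _ => hr.isFrac_of_add_smul

theorem LPFeasible.keeps {I : AdCell m n s} {y : Frac m n} (h : I.LPFeasible y) : I.Keeps y y :=
  ⟨h.1, h.2.1, h.2.2.1, fun i _ => h.2.2.2 i⟩

theorem Keeps.of_reachable {I : AdCell m n s} {y y' : Frac m n} (hy : I.Keeps y y)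
    (h : Relation.ReflTransGen I.Step y y') : I.Keeps y' y' := by
  induction h with
  | refl => exact hy
  | tail _ hstep _ => exact hstep.keeps_self

end AdCell

/-! ### A potential that decreases in every move -/

theorem add_lt_mul_of_le_of_lt {a b c w : ℕ} (ha : a ≤ c) (hb : b < w) : a * w + b < (c + 1) * w :=
  calc a * w + b < a * w + w := by gcongr
    _ ≤ (c + 1) * w := by rw [← Nat.succ_mul]; gcongr; exact Nat.succ_le_succ ha

theorem mul_add_lt_mul_add_of_lex {a a' b b' w : ℕ} (hb : b' < w)
    (h : a' < a ∨ a' ≤ a ∧ b' < b) : a' * w + b' < a * w + b := by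
  rcases h with hlt | ⟨hle, hlt⟩
  · exact (add_lt_mul_of_le_of_lt le_rfl hb).trans_le
      ((Nat.mul_le_mul_right w hlt).trans (Nat.le_add_right _ _))
  · exact Nat.add_lt_add_of_le_of_lt (Nat.mul_le_mul_right w hle) hlt

namespace AdCell

variable {m n s : ℕ} (I : AdCell m n s)

open Classical in
/-- The fractional edges. -/
noncomputable def fracEdges (y : Frac m n) : Finset (Fin m × Fin n) := {e | IsFrac y e.1 e.2}

open Classical in
/-- The queries whose assignment constraint is not tight. -/
noncomputable def looseQueries (y : Frac m n) : Finset (Fin n) := {j | queryLoad y j ≠ I.arrival j}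

open Classical in
/-- The kept linear constraints that are not tight. -/
noncomputable def looseRows (y : Frac m n) : Finset (Row m n s) :=
  {v | Active y v ∧ I.load y v ≠ I.bound v}

theorem mem_fracEdges {y : Frac m n} {e : Fin m × Fin n} :
    e ∈ fracEdges y ↔ IsFrac y e.1 e.2 := by
  simp [fracEdges]

theorem mem_looseQueries {y : Frac m n} {j : Fin n} :
    j ∈ I.looseQueries y ↔ queryLoad y j ≠ I.arrival j := by
  simp [looseQueries]

theorem mem_looseRows {y : Frac m n} {v : Row m n s} :
    v ∈ I.looseRows y ↔ Active y v ∧ I.load y v ≠ I.bound v := by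
  simp [looseRows]

/-- The numbers of fractional edges, of queries with slack and of kept linear constraints with
slack, compared lexicographically and encoded as the digits of one natural number. -/
noncomputable def potential (y : Frac m n) : ℕ :=
  (fracEdges y).card * ((n + 1) * (m + n + s + 1)) +
    ((I.looseQueries y).card * (m + n + s + 1) + (I.looseRows y).card)

theorem card_looseRows_lt (y : Frac m n) : (I.looseRows y).card < m + n + s + 1 := by
  have := Finset.card_le_univ (I.looseRows y)
  simp only [Fintype.card_sum, Fintype.card_fin] at this
  omega

theorem card_looseQueries_mul_add_lt (y : Frac m n) :
    (I.looseQueries y).card * (m + n + s + 1) + (I.looseRows y).card <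
      (n + 1) * (m + n + s + 1) :=
  add_lt_mul_of_le_of_lt (card_finset_fin_le _) (I.card_looseRows_lt y)

theorem potential_lt (y : Frac m n) :
    I.potential y < (m * n + 1) * ((n + 1) * (m + n + s + 1)) :=
  add_lt_mul_of_le_of_lt (by simpa using Finset.card_le_univ (fracEdges y))
    (I.card_looseQueries_mul_add_lt y)

theorem potential_lt_of_loose {y y' : Frac m n} (hfrac : ∀ i j, IsFrac y' i j → IsFrac y i j)
    (hloose : fracEdges y' = fracEdges y → I.looseQueries y' ⊂ I.looseQueries y ∨
      I.looseQueries y' ⊆ I.looseQueries y ∧ I.looseRows y' ⊂ I.looseRows y) :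
    I.potential y' < I.potential y := by
  have hsub : fracEdges y' ⊆ fracEdges y := fun e he =>
    mem_fracEdges.2 (hfrac _ _ (mem_fracEdges.1 he))
  refine mul_add_lt_mul_add_of_lex (I.card_looseQueries_mul_add_lt y') ?_
  by_cases hE : fracEdges y' = fracEdges y
  · refine .inr ⟨(congrArg _ hE).le, mul_add_lt_mul_add_of_lex (I.card_looseRows_lt y') ?_⟩
    exact (hloose hE).imp Finset.card_lt_card
      (And.imp Finset.card_le_card Finset.card_lt_card)
  · exact .inl (Finset.card_lt_card (hsub.ssubset_of_ne hE))

theorem active_congr {y y' : Frac m n} (hE : fracEdges y' = fracEdges y) (v : Row m n s) :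
    Active y' v ↔ Active y v := by
  have hfrac : ∀ i j, IsFrac y' i j ↔ IsFrac y i j := fun i j => by
    simpa only [mem_fracEdges] using Finset.ext_iff.1 hE (i, j)
  exact ⟨.of_imp fun i j => (hfrac i j).1, .of_imp fun i j => (hfrac i j).2⟩

theorem MaxStep.exists_row_of_fracEdges_eq {I : AdCell m n s} {y r : Frac m n} {α : ℝ}
    (h : I.MaxStep y r α) (hr : IsDirection y r) (hE : fracEdges (y + α • r) = fracEdges y) :
    ∃ v, Active y v ∧ 0 < I.load r v ∧ I.load (y + α • r) v = I.bound v := by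
  have hfrac : ∀ i j, r i j ≠ 0 → 0 < y i j + α * r i j ∧ y i j + α * r i j < 1 :=
    fun i j hij => (mem_fracEdges (y := y + α • r) (e := (i, j))).1
      (hE ▸ mem_fracEdges.2 (hr.2 i j hij))
  obtain ⟨e | e | v, hactive, hslope, htight⟩ := h.exists_tight <;>
    simp only [slope, slack] at hslope htight
  · linarith [(hfrac e.1 e.2 (by linarith)).1]
  · linarith [(hfrac e.1 e.2 (by linarith)).2]
  · exact ⟨v, hactive, hslope, by rw [load_add_smul, htight, add_sub_cancel]⟩

theorem looseQueries_add_smul_subset {y r : Frac m n} (α : ℝ)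
    (h : ∀ j, queryLoad y j = I.arrival j → queryLoad r j = 0) :
    I.looseQueries (y + α • r) ⊆ I.looseQueries y := by
  intro j hj
  rw [mem_looseQueries] at *
  intro htight
  have hadd : queryLoad (y + α • r) j = queryLoad y j + α * queryLoad r j :=
    I.load_add_smul y r α (.inr (.inl j))
  exact hj (by rw [hadd, h j htight, mul_zero, add_zero, htight])

theorem potential_lt_of_breakCycle {y z : Frac m n} {β : ℝ} (hz : IsDirection y z)
    (hpay : ∀ i, I.payment z i = 0) (hquery : ∀ j, queryLoad z j ≤ 0) (hβ : I.MaxStep y z β) :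
    I.potential (y + β • z) < I.potential y := by
  refine I.potential_lt_of_loose (fun i j => hz.isFrac_of_add_smul) fun hE => ?_
  obtain ⟨i | j | k, -, hpos, -⟩ := hβ.exists_row_of_fracEdges_eq hz hE
  · exact absurd (hpay i) hpos.ne'
  · exact absurd hpos (hquery j).not_gt
  · have hcustomer : I.customerLoad z k ≤ 0 := Finset.sum_nonpos fun j _ => hquery j
    exact absurd hpos hcustomer.not_gt

theorem MaxStep.load_eq_zero {I : AdCell m n s} {y r : Frac m n} {α β : ℝ} (hα : I.MaxStep y r α)
    (hβ : I.MaxStep y (-r) β) {v : Row m n s} (hv : Active y v) (htight : I.load y v = I.bound v) :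
    I.load r v = 0 := by
  have hup := ((I.keeps_iff _ _).1 hα.2.1).2 v hv
  have hdown := ((I.keeps_iff _ _).1 hβ.2.1).2 v hv
  rw [load_add_smul, htight] at hup hdown
  rw [load_neg] at hdown
  nlinarith [hα.1, hβ.1]

theorem potential_lt_of_randMove {y r : Frac m n} {α β : ℝ} (hr : IsDirection y r)
    (hα : I.MaxStep y r α) (hβ : I.MaxStep y (-r) β) :
    I.potential (y + α • r) < I.potential y := by
  refine I.potential_lt_of_loose (fun i j => hr.isFrac_of_add_smul) fun hE => .inr ⟨?_, ?_⟩
  · exact I.looseQueries_add_smul_subset α fun j hj =>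
      hα.load_eq_zero (v := .inr (.inl j)) hβ trivial hj
  · obtain ⟨v, hv, hpos, htight⟩ := hα.exists_row_of_fracEdges_eq hr hE
    refine (Finset.ssubset_iff_of_subset fun u hu => ?_).2 ⟨v, ?_, ?_⟩
    · rw [mem_looseRows, active_congr hE] at hu
      refine I.mem_looseRows.2 ⟨hu.1, fun hu' => hu.2 ?_⟩
      rw [load_add_smul, hα.load_eq_zero hβ hu.1 hu', mul_zero, add_zero, hu']
    · exact I.mem_looseRows.2 ⟨hv, fun h => hpos.ne' (hα.load_eq_zero hβ hv h)⟩
    · exact fun h => (I.mem_looseRows.1 h).2 htight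

theorem potential_lt_of_lowerTight {y z : Frac m n} {β : ℝ} (hz : IsDirection y z)
    (hpay : ∀ i, I.payment z i = 0)
    (hquery : ∀ j, queryLoad y j = I.arrival j → queryLoad z j = 0)
    (hcustomer : ∀ k, I.customerLoad z k ≤ 0) (hβ : I.MaxStep y z β) :
    I.potential (y + β • z) < I.potential y := by
  refine I.potential_lt_of_loose (fun i j => hz.isFrac_of_add_smul) fun hE => .inl ?_
  obtain ⟨i | j | k, -, hpos, htight⟩ := hβ.exists_row_of_fracEdges_eq hz hE
  · exact absurd (hpay i) hpos.ne'
  · refine (Finset.ssubset_iff_of_subset (I.looseQueries_add_smul_subset β hquery)).2 ⟨j, ?_, ?_⟩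
    · exact I.mem_looseQueries.2 fun h => hpos.ne' (hquery j h)
    · exact fun h => I.mem_looseQueries.1 h htight
  · exact absurd hpos (hcustomer k).not_gt

theorem nonpos_of_eq_zero_of_ne {ι : Type*} {f : ι → ℝ} {a : ι} (hne : ∀ b, b ≠ a → f b = 0)
    (ha : f a ≤ 0) (b : ι) : f b ≤ 0 := by
  rcases eq_or_ne b a with rfl | hb
  exacts [ha, (hne b hb).le]

theorem Step.potential_lt {I : AdCell m n s} {y y' : Frac m n} (h : I.Step y y') :
    I.potential y' < I.potential y := by
  obtain ⟨μ, hμ, hy'⟩ := h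
  cases hμ with
  | breakCycle z β j₀ _ hz hpay hquery hj₀ hβ =>
    obtain rfl : y' = y + β • z := by simpa using hy'
    exact I.potential_lt_of_breakCycle hz hpay (nonpos_of_eq_zero_of_ne hquery hj₀) hβ
  | randMove r α β _ hr hα hβ =>
    simp only [PMF.mix, PMF.mem_support_bind_iff] at hy'
    obtain ⟨heads, -, hmem⟩ := hy'
    cases heads
    · obtain rfl : y' = y + β • (-r) := by simpa [sub_eq_add_neg] using hmem
      exact I.potential_lt_of_randMove hr.neg hβ (by simpa using hα)
    · obtain rfl : y' = y + α • r := by simpa using hmem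
      exact I.potential_lt_of_randMove hr hα hβ
  | lowerTight z β k₀ _ hz hpay hquery _ hcustomer hk₀ hβ =>
    obtain rfl : y' = y + β • z := by simpa using hy'
    exact I.potential_lt_of_lowerTight hz hpay hquery (nonpos_of_eq_zero_of_ne hcustomer hk₀) hβ

theorem le_potential_of_steps {N : ℕ} {path : ℕ → Frac m n}
    (h : ∀ t < N, I.Step (path t) (path (t + 1))) : N ≤ I.potential (path 0) := by
  have hdrop : ∀ t ≤ N, I.potential (path t) + t ≤ I.potential (path 0) := by
    intro t ht
    induction t with
    | zero => rfl
    | succ t ih =>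
      have hlt := (h t ht).potential_lt
      have hle := ih (Nat.le_of_succ_le ht)
      omega
  exact (Nat.le_add_left _ _).trans (hdrop N le_rfl)

end AdCell

/-! ### Counting equations against fractional edges -/

theorem exists_leaf_of_isAcyclic {V : Type*} {G : SimpleGraph V} [Finite G.edgeSet]
    (hG : G.IsAcyclic) {a b : V} (hab : G.Adj a b) :
    ∃ v w, G.Adj v w ∧ ∀ w', G.Adj v w' → w' = w := by
  have : Nonempty V := ⟨a⟩
  obtain ⟨u, v, p, hp, hlongest⟩ := SimpleGraph.Walk.exists_isPath_forall_isPath_length_le_length G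
  have hnil : ¬ p.Nil := by
    have hpos : 1 ≤ p.length := hlongest a b hab.toWalk (by simpa using hab.ne)
    exact fun h => by simp [SimpleGraph.Walk.length_eq_zero_iff.2 h] at hpos
  refine ⟨v, p.penultimate, (p.adj_penultimate hnil).symm, fun w' hw' =>
    hG.eq_penultimate_of_adj_end hp hw' ?_⟩
  by_contra hsupport
  simpa using hlongest _ _ _ (hp.concat hsupport hw')

theorem card_toFinset_support_le_length {V : Type*} [DecidableEq V] {G : SimpleGraph V} {v : V}
    {c : G.Walk v v} (hc : ¬ c.Nil) : c.support.toFinset.card ≤ c.length := by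
  have htail : c.support.toFinset = c.support.tail.toFinset := by
    conv_lhs => rw [← c.cons_tail_support]
    rw [List.toFinset_cons, Finset.insert_eq_of_mem]
    exact List.mem_toFinset.2 (SimpleGraph.Walk.end_mem_tail_support hc)
  calc c.support.toFinset.card ≤ c.support.tail.length := htail ▸ List.toFinset_card_le _
    _ = c.length := by simp

theorem card_lt_or_forall_endpoints_mem {E V : Type*} [DecidableEq V] {F : Finset E} {C : Finset V}
    (f g : E → V) (hdeg : ∀ v ∈ C, 2 ≤ {e ∈ F | f e = v}.card + {e ∈ F | g e = v}.card) :
    C.card < F.card ∨ C.card = F.card ∧ ∀ e ∈ F, f e ∈ C ∧ g e ∈ C := by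
  have hcount : C.card * 2 ≤ {e ∈ F | f e ∈ C}.card + {e ∈ F | g e ∈ C}.card := by
    rw [← Finset.sum_card_fiberwise_eq_card_filter, ← Finset.sum_card_fiberwise_eq_card_filter,
      ← Finset.sum_add_distrib, ← smul_eq_mul]
    exact Finset.card_nsmul_le_sum C _ 2 hdeg
  have hf := Finset.card_filter_le F (f · ∈ C)
  have hg := Finset.card_filter_le F (g · ∈ C)
  refine or_iff_not_imp_left.2 fun hlt => ⟨by omega, fun e he => ⟨?_, ?_⟩⟩
  · exact Finset.card_filter_eq_iff.1 (show {e ∈ F | f e ∈ C}.card = F.card by omega) e he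
  · exact Finset.card_filter_eq_iff.1 (show {e ∈ F | g e ∈ C}.card = F.card by omega) e he

theorem exists_ne_notMem_of_sum_mem {ι G : Type*} [AddCommGroup G] {H : AddSubgroup G}
    {t : Finset ι} {f : ι → G} {a : ι} (ha : a ∈ t) (hsum : ∑ b ∈ t, f b ∈ H) (hfa : f a ∉ H) :
    ∃ b ∈ t, b ≠ a ∧ f b ∉ H := by
  classical
  by_contra! h
  rw [← Finset.add_sum_erase t f ha] at hsum
  exact hfa ((H.add_mem_cancel_right (sum_mem fun b hb =>
    h b (Finset.mem_of_mem_erase hb) (Finset.ne_of_mem_erase hb))).1 hsum)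

theorem notMem_range_intCast {x : ℝ} (h0 : 0 < x) (h1 : x < 1) :
    x ∉ (Int.castAddHom ℝ).range := by
  rintro ⟨k, rfl⟩
  simp only [Int.coe_castAddHom] at h0 h1
  norm_cast at h0 h1
  omega

namespace AdCell

variable {m n s : ℕ} (I : AdCell m n s)

/-- The combinatorial data on which the choice of a move depends. -/
structure Pattern (m n s : ℕ) where
  customer : Fin n → Fin s
  frac : Fin m → Fin n → Prop
  tightQuery : Fin n → Prop
  tightCustomer : Fin s → Prop

/-- The pattern of a fractional solution. -/
def pattern (y : Frac m n) : Pattern m n s where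
  customer := I.customer
  frac := IsFrac y
  tightQuery j := queryLoad y j = I.arrival j
  tightCustomer k := I.customerLoad y k = I.capacity k

namespace Pattern

variable (P : Pattern m n s)

/-- The graph of the fractional edges. -/
def graph : SimpleGraph (Fin m ⊕ Fin n) :=
  SimpleGraph.fromRel fun a b => ∃ i j, a = Sum.inl i ∧ b = Sum.inr j ∧ P.frac i j

open Classical in
/-- The fractional edges. -/
noncomputable def edges : Finset (Fin m × Fin n) := {e | P.frac e.1 e.2}

open Classical in
/-- The constraint that limits the total of query `j` in a Rand-Move: its own assignment constraint
if that is tight, otherwise the capacity of its customer. -/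
noncomputable def queryRow (j : Fin n) : Row m n s :=
  if P.tightQuery j then .inr (.inl j) else .inr (.inr (P.customer j))

/-- The linear constraints whose left-hand side has to stay constant in a Rand-Move. -/
def Rigid : Row m n s → Prop
  | .inl i => 2 ≤ Set.ncard {j | P.frac i j}
  | .inr (.inl j) => P.tightQuery j
  | .inr (.inr k) => P.tightCustomer k

open Classical in
/-- The rigid constraints that are the budget constraint or the query row of a fractional edge. -/
noncomputable def rigidRows : Finset (Row m n s) :=
  {v | P.Rigid v ∧ ∃ e ∈ P.edges, .inl e.1 = v ∨ P.queryRow e.2 = v}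

/-- A combinatorial condition under which, for vectors supported on `F`, vanishing of the
left-hand sides of all `w ∈ C` implies vanishing of the left-hand side of `v`. -/
def Forces (F : Finset (Fin m × Fin n)) (C : Finset (Row m n s)) : Row m n s → Prop
  | .inl i => ∀ e ∈ F, e.1 = i → .inl i ∈ C
  | .inr (.inl j) => ∀ e ∈ F, e.2 = j → .inr (.inl j) ∈ C
  | .inr (.inr k) => ∀ e ∈ F, P.customer e.2 = k → .inr (.inl e.2) ∈ C ∨ .inr (.inr k) ∈ C

/-- The nonzero solutions, supported on `F`, of the homogeneous equations `C` are the directions of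
a deterministic move, provided that they do not increase the left-hand side of the given
constraint. -/
inductive DeterministicPlan (F : Finset (Fin m × Fin n)) (C : Finset (Row m n s)) :
    Row m n s → Prop
  | breakCycle (j₀ : Fin n) : ¬ P.graph.IsAcyclic → (∀ i, P.Forces F C (.inl i)) →
      (∀ j, j ≠ j₀ → P.Forces F C (.inr (.inl j))) → DeterministicPlan F C (.inr (.inl j₀))
  | lowerTight (k₀ : Fin s) : P.graph.IsAcyclic → (∀ i, P.Forces F C (.inl i)) →
      (∀ j, P.tightQuery j → P.Forces F C (.inr (.inl j))) → P.tightCustomer k₀ →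
      (∀ k, k ≠ k₀ → P.Forces F C (.inr (.inr k))) → DeterministicPlan F C (.inr (.inr k₀))

/-- The nonzero solutions, supported on `F`, of the homogeneous equations `C` are the directions of
a Rand-Move. -/
def RandomPlan (F : Finset (Fin m × Fin n)) (C : Finset (Row m n s)) : Prop :=
  P.graph.IsAcyclic ∧ ∀ v, P.Rigid v → P.Forces F C v

/-- The homogeneous equations `C` for vectors supported on the fractional edges `F` are fewer than
their unknowns, and their solutions are the directions of a move. -/
structure Plan (F : Finset (Fin m × Fin n)) (C : Finset (Row m n s)) : Prop where
  frac : ∀ e ∈ F, P.frac e.1 e.2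
  card_lt : C.card < F.card
  move : (∃ v, P.DeterministicPlan F C v) ∨ P.RandomPlan F C

theorem mem_edges {e : Fin m × Fin n} : e ∈ P.edges ↔ P.frac e.1 e.2 := by
  simp [edges]

theorem queryRow_of_tight {j : Fin n} (h : P.tightQuery j) : P.queryRow j = .inr (.inl j) :=
  if_pos h

theorem queryRow_of_not_tight {j : Fin n} (h : ¬ P.tightQuery j) :
    P.queryRow j = .inr (.inr (P.customer j)) :=
  if_neg h

theorem mem_rigidRows {v : Row m n s} :
    v ∈ P.rigidRows ↔ P.Rigid v ∧ ∃ e ∈ P.edges, .inl e.1 = v ∨ P.queryRow e.2 = v := by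
  simp [rigidRows]

theorem graph_adj_inl_inr {i : Fin m} {j : Fin n} :
    P.graph.Adj (.inl i) (.inr j) ↔ P.frac i j := by
  simp [graph, SimpleGraph.fromRel_adj]

theorem exists_of_graph_adj {a b : Fin m ⊕ Fin n} (h : P.graph.Adj a b) :
    ∃ e : Fin m × Fin n, P.frac e.1 e.2 ∧ s(.inl e.1, .inr e.2) = s(a, b) := by
  rw [graph, SimpleGraph.fromRel_adj] at h
  obtain ⟨-, ⟨i, j, rfl, rfl, h⟩ | ⟨i, j, rfl, rfl, h⟩⟩ := h
  · exact ⟨(i, j), h, rfl⟩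
  · exact ⟨(i, j), h, Sym2.eq_swap⟩

open Classical in
/-- The edges of a walk, as pairs of an advertiser and a query. -/
noncomputable def walkEdges {a b : Fin m ⊕ Fin n} (c : P.graph.Walk a b) :
    Finset (Fin m × Fin n) :=
  {e | s(.inl e.1, .inr e.2) ∈ c.edges}

theorem mem_walkEdges {a b : Fin m ⊕ Fin n} {c : P.graph.Walk a b} {e : Fin m × Fin n} :
    e ∈ P.walkEdges c ↔ s(.inl e.1, .inr e.2) ∈ c.edges := by
  simp [walkEdges]

theorem length_le_card_walkEdges {a b : Fin m ⊕ Fin n} {c : P.graph.Walk a b} (hc : c.IsTrail) :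
    c.length ≤ (P.walkEdges c).card := by
  classical
  rw [← c.length_edges, ← List.toFinset_card_of_nodup hc.edges_nodup]
  refine Finset.card_le_card_of_surjOn (fun e => s(.inl e.1, .inr e.2)) fun x hx => ?_
  induction x with
  | _ u v =>
    have hmem : s(u, v) ∈ c.edges := by simpa using hx
    obtain ⟨e, -, heq⟩ := P.exists_of_graph_adj (c.adj_of_mem_edges hmem)
    exact ⟨e, P.mem_walkEdges.2 (heq ▸ hmem), heq⟩

theorem exists_plan_of_not_isAcyclic (h : ¬ P.graph.IsAcyclic) : ∃ F C, P.Plan F C := by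
  classical
  obtain ⟨a, c, hc⟩ : ∃ a, ∃ c : P.graph.Walk a a, c.IsCycle := by
    simpa only [SimpleGraph.IsAcyclic, not_forall, not_not] using h
  have hlength := P.length_le_card_walkEdges hc.isTrail
  obtain ⟨e₀, he₀⟩ : (P.walkEdges c).Nonempty :=
    Finset.card_pos.1 ((Nat.zero_lt_of_lt hc.three_le_length).trans_le hlength)
  have hsupport : ∀ e ∈ P.walkEdges c,
      .inl e.1 ∈ c.support.toFinset ∧ .inr e.2 ∈ c.support.toFinset := fun e he =>
    ⟨List.mem_toFinset.2 (c.fst_mem_support_of_mem_edges (P.mem_walkEdges.1 he)),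
      List.mem_toFinset.2 (c.snd_mem_support_of_mem_edges (P.mem_walkEdges.1 he))⟩
  refine ⟨P.walkEdges c, (c.support.toFinset.erase (.inr e₀.2)).image (Sum.map id Sum.inl),
    fun e he => P.graph_adj_inl_inr.1 (c.adj_of_mem_edges (P.mem_walkEdges.1 he)), ?_,
    .inl ⟨_, .breakCycle e₀.2 h ?_ ?_⟩⟩
  · calc ((c.support.toFinset.erase (.inr e₀.2)).image (Sum.map id Sum.inl)).card
        ≤ (c.support.toFinset.erase (.inr e₀.2)).card := Finset.card_image_le
      _ < c.support.toFinset.card := Finset.card_erase_lt_of_mem (hsupport e₀ he₀).2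
      _ ≤ c.length := card_toFinset_support_le_length hc.not_nil
      _ ≤ (P.walkEdges c).card := hlength
  · rintro _ e he rfl
    exact Finset.mem_image.2 ⟨.inl e.1, by simpa using (hsupport e he).1, rfl⟩
  · rintro _ hne e he rfl
    exact Finset.mem_image.2 ⟨.inr e.2, by simpa [hne] using (hsupport e he).2, rfl⟩

variable {P}

theorem exists_ne_of_rigid_inl {e : Fin m × Fin n} (h : P.Rigid (.inl e.1)) :
    ∃ e' ∈ P.edges, e' ≠ e ∧ e'.1 = e.1 := by
  obtain ⟨j, hj, hne⟩ := Set.exists_ne_of_one_lt_ncard h e.2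
  exact ⟨(e.1, j), P.mem_edges.2 hj, fun heq => hne (congrArg Prod.snd heq), rfl⟩

theorem two_le_card_of_mem_rigidRows
    (hpair : ∀ e ∈ P.edges, P.Rigid (P.queryRow e.2) →
      ∃ e' ∈ P.edges, e' ≠ e ∧ P.queryRow e'.2 = P.queryRow e.2)
    {v : Row m n s} (hv : v ∈ P.rigidRows) :
    2 ≤ {e ∈ P.edges | .inl e.1 = v}.card + {e ∈ P.edges | P.queryRow e.2 = v}.card := by
  obtain ⟨hrigid, e, he, rfl | rfl⟩ := P.mem_rigidRows.1 hv
  · obtain ⟨e', he', hne, heq⟩ := exists_ne_of_rigid_inl hrigid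
    exact le_add_right (Finset.one_lt_card.2 ⟨e', by simp [he', heq], e, by simp [he], hne⟩)
  · obtain ⟨e', he', hne, heq⟩ := hpair e he hrigid
    exact le_add_left (Finset.one_lt_card.2 ⟨e', by simp [he', heq], e, by simp [he], hne⟩)

theorem forces_rigidRows {v : Row m n s} (hv : P.Rigid v) :
    P.Forces P.edges P.rigidRows v := by
  rcases v with i | j | k
  · rintro e he rfl
    exact P.mem_rigidRows.2 ⟨hv, e, he, .inl rfl⟩
  · rintro e he rfl
    exact P.mem_rigidRows.2 ⟨hv, e, he, .inr (P.queryRow_of_tight hv)⟩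
  · rintro e he rfl
    by_cases htight : P.tightQuery e.2
    · exact .inl (P.mem_rigidRows.2 ⟨htight, e, he, .inr (P.queryRow_of_tight htight)⟩)
    · exact .inr (P.mem_rigidRows.2 ⟨hv, e, he, .inr (P.queryRow_of_not_tight htight)⟩)

theorem exists_not_tightQuery_of_isAcyclic (h : P.graph.IsAcyclic) (hne : P.edges.Nonempty)
    (hpair : ∀ e ∈ P.edges, P.Rigid (P.queryRow e.2) →
      ∃ e' ∈ P.edges, e' ≠ e ∧ P.queryRow e'.2 = P.queryRow e.2)
    (hadv : ∀ e ∈ P.edges, P.Rigid (.inl e.1)) :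
    ∃ e ∈ P.edges, ¬ P.tightQuery e.2 := by
  by_contra! htight
  obtain ⟨e₀, he₀⟩ := hne
  obtain ⟨v, w, hvw, huniq⟩ :=
    exists_leaf_of_isAcyclic h (P.graph_adj_inl_inr.2 (P.mem_edges.1 he₀))
  obtain ⟨e, he, heq⟩ := P.exists_of_graph_adj hvw
  rw [← mem_edges] at he
  rcases Sym2.eq_iff.1 heq with ⟨rfl, rfl⟩ | ⟨rfl, rfl⟩
  · obtain ⟨⟨i, j⟩, he', hne, rfl⟩ := exists_ne_of_rigid_inl (hadv e he)
    have := huniq (.inr j) (P.graph_adj_inl_inr.2 (P.mem_edges.1 he'))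
    exact hne (Prod.ext rfl (Sum.inr_injective this))
  · have hrow : ∀ e ∈ P.edges, P.queryRow e.2 = .inr (.inl e.2) := fun e he =>
      P.queryRow_of_tight (htight e he)
    obtain ⟨⟨i, j⟩, he', hne, hrow'⟩ := hpair e he (by rw [hrow e he]; exact htight e he)
    obtain rfl : j = e.2 := by simpa [hrow e he, hrow _ he'] using hrow'
    have := huniq (.inl i) (P.graph_adj_inl_inr.2 (P.mem_edges.1 he')).symm
    exact hne (Prod.ext (Sum.inl_injective this) rfl)

theorem deterministicPlan_of_forall_mem_rigidRows (h : P.graph.IsAcyclic)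
    (hadv : ∀ e ∈ P.edges, .inl e.1 ∈ P.rigidRows)
    (hquery : ∀ e ∈ P.edges, P.queryRow e.2 ∈ P.rigidRows) {k : Fin s}
    (hk : P.tightCustomer k) :
    P.DeterministicPlan P.edges (P.rigidRows.erase (.inr (.inr k))) (.inr (.inr k)) := by
  refine .lowerTight k h ?_ (fun j hj => ?_) hk fun k' hk' => ?_
  · rintro _ e he rfl
    simpa using hadv e he
  · rintro e he rfl
    simpa [P.queryRow_of_tight hj] using hquery e he
  · rintro e he rfl
    by_cases htight : P.tightQuery e.2
    · left
      simpa [P.queryRow_of_tight htight] using hquery e he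
    · right
      simpa [P.queryRow_of_not_tight htight, hk'] using hquery e he

theorem exists_plan_of_isAcyclic (h : P.graph.IsAcyclic) (hne : P.edges.Nonempty)
    (hpair : ∀ e ∈ P.edges, P.Rigid (P.queryRow e.2) →
      ∃ e' ∈ P.edges, e' ≠ e ∧ P.queryRow e'.2 = P.queryRow e.2) :
    ∃ F C, P.Plan F C := by
  rcases card_lt_or_forall_endpoints_mem _ _ fun _ => two_le_card_of_mem_rigidRows hpair with
    hlt | ⟨hcard, hmem⟩
  · exact ⟨P.edges, P.rigidRows, fun e => P.mem_edges.1, hlt, .inr ⟨h, fun _ => forces_rigidRows⟩⟩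
  · obtain ⟨e, he, hloose⟩ := exists_not_tightQuery_of_isAcyclic h hne hpair fun e he =>
      (P.mem_rigidRows.1 (hmem e he).1).1
    have hrow := (hmem e he).2
    rw [P.queryRow_of_not_tight hloose] at hrow
    refine ⟨P.edges, P.rigidRows.erase (.inr (.inr (P.customer e.2))), fun e => P.mem_edges.1,
      hcard ▸ Finset.card_erase_lt_of_mem hrow, .inl ⟨.inr (.inr (P.customer e.2)), ?_⟩⟩
    exact deterministicPlan_of_forall_mem_rigidRows h (fun e he => (hmem e he).1)
      (fun e he => (hmem e he).2) (P.mem_rigidRows.1 hrow).1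

end Pattern

theorem Box.mem_range_intCast {y : Frac m n} (hy : Box y) {i : Fin m} {j : Fin n}
    (h : ¬ IsFrac y i j) : y i j ∈ (Int.castAddHom ℝ).range := by
  rcases hy.eq_zero_or_eq_one h with h | h <;> rw [h]
  exacts [⟨0, by simp⟩, ⟨1, by simp⟩]

theorem arrival_mem_range_intCast (j : Fin n) : I.arrival j ∈ (Int.castAddHom ℝ).range := by
  unfold arrival
  split_ifs
  exacts [⟨1, by simp⟩, ⟨0, by simp⟩]

theorem arrival_le_one (j : Fin n) : I.arrival j ≤ 1 := by
  unfold arrival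
  split_ifs <;> simp

variable {I}

theorem Keeps.exists_ne_isFrac_of_tight_query {y : Frac m n} (hy : I.Keeps y y) {i : Fin m}
    {j : Fin n} (hij : IsFrac y i j) (htight : queryLoad y j = I.arrival j) :
    ∃ i', i' ≠ i ∧ IsFrac y i' j := by
  obtain ⟨i', -, hne, hi'⟩ := exists_ne_notMem_of_sum_mem (f := fun i => y i j) (Finset.mem_univ i)
    (htight ▸ I.arrival_mem_range_intCast j :) (notMem_range_intCast hij.1 hij.2)
  exact ⟨i', hne, not_not.1 fun h => hi' (hy.1.mem_range_intCast h)⟩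

theorem Keeps.exists_ne_isFrac_of_tight_customer {y : Frac m n} (hy : I.Keeps y y) {i : Fin m}
    {j : Fin n} (hij : IsFrac y i j) (hloose : queryLoad y j ≠ I.arrival j)
    (htight : I.customerLoad y (I.customer j) = I.capacity (I.customer j)) :
    ∃ i' j', j' ≠ j ∧ IsFrac y i' j' ∧ queryLoad y j' ≠ I.arrival j' ∧
      I.customer j' = I.customer j := by
  obtain ⟨hbox, hassign, -, -⟩ := hy
  have hpos : 0 < queryLoad y j := hij.1.trans_le
    (Finset.single_le_sum (f := fun i => y i j) (fun i _ => (hbox i j).1) (Finset.mem_univ i))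
  have hlt : queryLoad y j < 1 := ((hassign j).lt_of_ne hloose).trans_le (I.arrival_le_one j)
  have hcapacity : I.customerLoad y (I.customer j) ∈ (Int.castAddHom ℝ).range :=
    ⟨I.capacity (I.customer j), by simp [htight]⟩
  obtain ⟨j', hj', hne, hfrac⟩ :=
    exists_ne_notMem_of_sum_mem (by simp) hcapacity (notMem_range_intCast hpos hlt)
  obtain ⟨i', -, hi'⟩ : ∃ i' ∈ Finset.univ, ¬ y i' j' ∈ (Int.castAddHom ℝ).range := by
    by_contra! h
    exact hfrac (sum_mem h)
  exact ⟨i', j', hne, not_not.1 fun h => hi' (hbox.mem_range_intCast h),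
    fun h => hfrac (h ▸ I.arrival_mem_range_intCast j'), (Finset.mem_filter.1 hj').2⟩

theorem Keeps.exists_plan {y : Frac m n} (hy : I.Keeps y y) (hr : ¬ Rounded y) :
    ∃ F C, (I.pattern y).Plan F C := by
  by_cases hacyclic : (I.pattern y).graph.IsAcyclic
  · refine Pattern.exists_plan_of_isAcyclic hacyclic ?_ ?_
    · by_contra! hempty
      refine hr fun i j => hy.1.eq_zero_or_eq_one fun hij => ?_
      exact Finset.notMem_empty (i, j) (hempty ▸ (I.pattern y).mem_edges.2 hij)
    · intro e he hrigid
      rw [Pattern.mem_edges] at he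
      by_cases htight : (I.pattern y).tightQuery e.2
      · obtain ⟨i', hne, hi'⟩ := hy.exists_ne_isFrac_of_tight_query he htight
        exact ⟨(i', e.2), (Pattern.mem_edges _).2 hi', fun h => hne (congrArg Prod.fst h), rfl⟩
      · rw [Pattern.queryRow_of_not_tight _ htight] at hrigid ⊢
        obtain ⟨i', j', hne, hfrac, hloose, hcustomer⟩ :=
          hy.exists_ne_isFrac_of_tight_customer he htight hrigid
        refine ⟨(i', j'), (Pattern.mem_edges _).2 hfrac, fun h => hne (congrArg Prod.snd h), ?_⟩
        rw [Pattern.queryRow_of_not_tight _ hloose]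
        exact congrArg _ (congrArg _ hcustomer)
  · exact (I.pattern y).exists_plan_of_not_isAcyclic hacyclic

end AdCell

/-! ### From plans to moves -/

namespace AdCell

variable {m n s : ℕ} (I : AdCell m n s)

/-- `z` is a nonzero solution, supported on `F`, of the homogeneous equations `C`. -/
structure Solves (F : Finset (Fin m × Fin n)) (C : Finset (Row m n s)) (z : Frac m n) : Prop where
  ne_zero : z ≠ 0
  support : ∀ e : Fin m × Fin n, e ∉ F → z e.1 e.2 = 0
  load : ∀ v ∈ C, I.load z v = 0

variable {I} {F : Finset (Fin m × Fin n)} {C : Finset (Row m n s)} {y z : Frac m n}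

theorem Solves.neg (h : I.Solves F C z) : I.Solves F C (-z) where
  ne_zero := neg_ne_zero.2 h.ne_zero
  support e he := by simp [h.support e he]
  load v hv := by rw [load_neg, h.load v hv, neg_zero]

theorem Solves.isDirection (h : I.Solves F C z) (hF : ∀ e ∈ F, IsFrac y e.1 e.2) :
    IsDirection y z := by
  refine ⟨h.ne_zero, fun i j hij => ?_⟩
  by_contra hfrac
  exact hij (h.support (i, j) fun he => hfrac (hF _ he))

theorem Solves.load_eq_zero (h : I.Solves F C z) {v : Row m n s}
    (hv : (I.pattern y).Forces F C v) : I.load z v = 0 := by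
  have hquery : ∀ j, (∀ e ∈ F, e.2 = j → .inr (.inl j) ∈ C) → queryLoad z j = 0 := fun j hj => by
    by_cases hC : .inr (.inl j) ∈ C
    · exact h.load _ hC
    · exact Finset.sum_eq_zero fun i _ => h.support (i, j) fun he => hC (hj _ he rfl)
  rcases v with i | j | k
  · by_cases hC : .inl i ∈ C
    · exact h.load _ hC
    · change I.payment z i = 0
      refine Finset.sum_eq_zero fun j _ => ?_
      exact mul_eq_zero_of_left (h.support (i, j) fun he => hC (hv _ he rfl)) _
  · exact hquery j hv
  · by_cases hC : .inr (.inr k) ∈ C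
    · exact h.load _ hC
    · change I.customerLoad z k = 0
      refine Finset.sum_eq_zero fun j hj => hquery j ?_
      rintro e he rfl
      exact (hv e he (Finset.mem_filter.1 hj).2).resolve_right hC

theorem IsDirection.allows (hz : IsDirection y z)
    (h : ∀ v, Active y v → 0 < I.load z v → I.load y v < I.bound v) : I.Allows y z := by
  rintro (e | e | v) hc hslope
  · exact (hz.2 _ _ (neg_pos.1 hslope).ne).1
  · exact sub_pos.2 (hz.2 _ _ hslope.ne').2
  · exact sub_pos.2 (h v hc hslope)

theorem Solves.allows_of_deterministicPlan (h : I.Solves F C z) (hy : I.Keeps y y)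
    (hF : ∀ e ∈ F, IsFrac y e.1 e.2) {v : Row m n s}
    (hplan : (I.pattern y).DeterministicPlan F C v) (hv : I.load z v ≤ 0) : I.Allows y z := by
  refine (h.isDirection hF).allows ?_
  cases hplan with
  | breakCycle j₀ _ hadv hquery =>
    have hnonpos : ∀ j, queryLoad z j ≤ 0 :=
      nonpos_of_eq_zero_of_ne (fun j hj => h.load_eq_zero (hquery j hj)) hv
    have hcustomer : ∀ k, I.customerLoad z k ≤ 0 := fun k =>
      Finset.sum_nonpos fun j _ => hnonpos j
    rintro (i | j | k) - hpos
    · exact absurd (h.load_eq_zero (hadv i)) hpos.ne'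
    · exact absurd hpos (hnonpos j).not_gt
    · exact absurd hpos (hcustomer k).not_gt
  | lowerTight k₀ _ hadv hquery _ hcustomer =>
    have hnonpos : ∀ k, I.customerLoad z k ≤ 0 :=
      nonpos_of_eq_zero_of_ne (fun k hk => h.load_eq_zero (hcustomer k hk)) hv
    rintro (i | j | k) - hpos
    · exact absurd (h.load_eq_zero (hadv i)) hpos.ne'
    · exact (hy.2.1 j).lt_of_ne fun htight => hpos.ne' (h.load_eq_zero (hquery j htight))
    · exact absurd hpos (hnonpos k).not_gt

theorem Solves.move_of_deterministicPlan (h : I.Solves F C z) (hF : ∀ e ∈ F, IsFrac y e.1 e.2)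
    {v : Row m n s} (hplan : (I.pattern y).DeterministicPlan F C v) (hv : I.load z v ≤ 0) {β : ℝ}
    (hβ : I.MaxStep y z β) : I.Move y (PMF.pure (y + β • z)) := by
  cases hplan with
  | breakCycle j₀ hcyclic hadv hquery =>
    exact .breakCycle z β j₀ hcyclic (h.isDirection hF) (fun i => h.load_eq_zero (hadv i))
      (fun j hj => h.load_eq_zero (hquery j hj)) hv hβ
  | lowerTight k₀ hacyclic hadv hquery htight hcustomer =>
    exact .lowerTight z β k₀ hacyclic (h.isDirection hF) (fun i => h.load_eq_zero (hadv i))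
      (fun j hj => h.load_eq_zero (hquery j hj)) htight
      (fun k hk => h.load_eq_zero (hcustomer k hk)) hv hβ

theorem Solves.allows_of_randomPlan (h : I.Solves F C z) (hy : I.Keeps y y)
    (hF : ∀ e ∈ F, IsFrac y e.1 e.2) (hplan : (I.pattern y).RandomPlan F C) : I.Allows y z := by
  refine (h.isDirection hF).allows fun v hv hpos => ?_
  refine (((I.keeps_iff _ _).1 hy).2 v hv).lt_of_ne fun htight => hpos.ne' ?_
  have hrigid : (I.pattern y).Rigid v := by
    rcases v with i | j | k
    exacts [hv, htight, htight]
  exact h.load_eq_zero (hplan.2 v hrigid)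

theorem Solves.move_of_randomPlan (h : I.Solves F C z) (hF : ∀ e ∈ F, IsFrac y e.1 e.2)
    (hplan : (I.pattern y).RandomPlan F C) {α β : ℝ} (hα : I.MaxStep y z α)
    (hβ : I.MaxStep y (-z) β) :
    I.Move y (PMF.mix (β / (α + β)) (PMF.pure (y + α • z)) (PMF.pure (y - β • z))) :=
  .randMove z α β hplan.1 (h.isDirection hF) hα hβ

end AdCell

/-! ### Expectations under finite mixtures -/

theorem mix_apply {α : Type*} (p : ℝ) (D₁ D₂ : PMF α) (a : α) :
    PMF.mix p D₁ D₂ a =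
      min (ENNReal.ofReal p) 1 * D₁ a + (1 - min (ENNReal.ofReal p) 1) * D₂ a := by
  simp [PMF.mix, PMF.bind_apply, realCoin]

theorem mix_bind {α β : Type*} (p : ℝ) (D₁ D₂ : PMF α) (K : α → PMF β) :
    (PMF.mix p D₁ D₂).bind K = PMF.mix p (D₁.bind K) (D₂.bind K) := by
  rw [PMF.mix, PMF.bind_bind]
  congr 1
  funext heads
  cases heads <;> simp

theorem mem_support_mix_left {α : Type*} {p : ℝ} (hp : 0 < p) {D₁ D₂ : PMF α} {a : α}
    (h : a ∈ D₁.support) : a ∈ (PMF.mix p D₁ D₂).support := by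
  rw [PMF.mem_support_iff] at *
  simp [mix_apply, h, hp]

theorem mem_support_mix_right {α : Type*} {p : ℝ} (hp : p < 1) {D₁ D₂ : PMF α} {a : α}
    (h : a ∈ D₂.support) : a ∈ (PMF.mix p D₁ D₂).support := by
  have hheads : min (ENNReal.ofReal p) 1 < 1 := by simp [hp]
  rw [PMF.mem_support_iff] at *
  simp [mix_apply, h, tsub_eq_zero_iff_le, hheads.not_ge]

section Expect

variable {α : Type*} [Fintype α]

theorem expect_pure (a : α) (f : α → ℝ) : (PMF.pure a).expect f = f a := by
  classical
  rw [PMF.expect, Finset.sum_eq_single a] <;> simp +contextual [PMF.pure_apply]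

theorem expect_mix {p : ℝ} (h0 : 0 ≤ p) (h1 : p ≤ 1) (D₁ D₂ : PMF α) (f : α → ℝ) :
    (PMF.mix p D₁ D₂).expect f = p * D₁.expect f + (1 - p) * D₂.expect f := by
  have hmin : min (ENNReal.ofReal p) 1 = ENNReal.ofReal p := by simp [h1]
  have hsub : (1 : ENNReal) - ENNReal.ofReal p = ENNReal.ofReal (1 - p) := by
    rw [ENNReal.ofReal_sub 1 h0, ENNReal.ofReal_one]
  have htop : ∀ (q : ℝ) (D : PMF α) (a : α), ENNReal.ofReal q * D a ≠ ⊤ := fun q D a =>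
    ENNReal.mul_ne_top ENNReal.ofReal_ne_top (D.apply_ne_top a)
  simp only [PMF.expect, Finset.mul_sum, ← Finset.sum_add_distrib]
  refine Finset.sum_congr rfl fun a _ => ?_
  rw [mix_apply, hmin, hsub, ENNReal.toReal_add (htop _ _ _) (htop _ _ _), ENNReal.toReal_mul,
    ENNReal.toReal_mul, ENNReal.toReal_ofReal h0, ENNReal.toReal_ofReal (sub_nonneg.2 h1)]
  ring

theorem expect_sum {ι : Type*} (t : Finset ι) (D : PMF α) (f : ι → α → ℝ) :
    D.expect (fun a => ∑ i ∈ t, f i a) = ∑ i ∈ t, D.expect (f i) := by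
  simp only [PMF.expect, Finset.mul_sum]
  exact Finset.sum_comm

theorem expect_const_add_mul (D : PMF α) (c d : ℝ) (f : α → ℝ) :
    D.expect (fun a => d + c * f a) = d + c * D.expect f := by
  have hone : ∑ a, (D a).toReal = 1 := by
    rw [← ENNReal.toReal_sum fun a _ => D.apply_ne_top a,
      ← tsum_fintype (L := .unconditional _), D.tsum_coe, ENNReal.toReal_one]
  simp only [PMF.expect, mul_add, Finset.sum_add_distrib, ← Finset.sum_mul, hone, one_mul,
    mul_left_comm _ c, ← Finset.mul_sum]

theorem expect_mono {D : PMF α} {f g : α → ℝ} (h : ∀ a ∈ D.support, f a ≤ g a) :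
    D.expect f ≤ D.expect g := by
  refine Finset.sum_le_sum fun a _ => ?_
  by_cases ha : a ∈ D.support
  · exact mul_le_mul_of_nonneg_left (h a ha) ENNReal.toReal_nonneg
  · simp [(D.apply_eq_zero_iff a).2 ha]

end Expect

/-! ### The expected revenue -/

theorem div_add_mem_Ioo {α β : ℝ} (hα : 0 < α) (hβ : 0 < β) : β / (α + β) ∈ Set.Ioo 0 1 :=
  ⟨by positivity, (div_lt_one (by positivity)).2 (by linarith)⟩

theorem mul_overshoot_le {a b p B : ℝ} (ha : 0 ≤ a) (hb : 0 ≤ b) (hp : 0 ≤ p) (hB : 0 ≤ B)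
    (h : a + p * b ≤ B) : p * (a + b - B) * (4 * B) ≤ b * (a + p * b) := by
  rcases le_total (4 * B * p) b with hc | hc
  · nlinarith [mul_nonneg ha (sub_nonneg.2 hc), mul_nonneg hp (sq_nonneg (b - 2 * B))]
  · nlinarith [mul_nonneg (sub_nonneg.2 h) (sub_nonneg.2 hc),
      mul_nonneg (mul_nonneg hB hb) (sq_nonneg (1 - 2 * p))]

/-- If the payment of an advertiser is `a` or `a + b`, then its expectation `a + p * b` bounds the
expected revenue from below through an affine minorant of `min · B` on `{a, a + b}`. -/
theorem exists_affine_le_min {a b p B ε : ℝ} (ha : 0 ≤ a) (hb : 0 ≤ b) (hp : 0 ≤ p) (hB : 0 < B)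
    (hε : b ≤ ε * B) (h : a + p * b ≤ B) :
    ∃ c d, 0 ≤ c ∧ d + c * a ≤ min a B ∧ d + c * (a + b) ≤ min (a + b) B ∧
      (1 - ε / 4) * (a + p * b) ≤ d + c * (a + p * b) := by
  have haB : a ≤ B := (le_add_of_nonneg_right (mul_nonneg hp hb)).trans h
  have hε0 : 0 ≤ ε := nonneg_of_mul_nonneg_left (hb.trans hε) hB
  have hmean : 0 ≤ a + p * b := add_nonneg ha (mul_nonneg hp hb)
  rw [min_eq_left haB]
  rcases le_or_gt (a + b) B with hab | hab
  · refine ⟨1, 0, zero_le_one, by simp, by simp [hab], ?_⟩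
    nlinarith [mul_nonneg hε0 hmean]
  · have hb0 : 0 < b := by linarith
    have hc : (B - a) / b * b = B - a := div_mul_cancel₀ _ hb0.ne'
    have hloss : p * (a + b - B) * 4 ≤ ε * (a + p * b) := by
      refine le_of_mul_le_mul_right ?_ hB
      calc p * (a + b - B) * 4 * B = p * (a + b - B) * (4 * B) := by ring
        _ ≤ b * (a + p * b) := mul_overshoot_le ha hb hp hB.le h
        _ ≤ ε * B * (a + p * b) := mul_le_mul_of_nonneg_right hε hmean
        _ = ε * (a + p * b) * B := by ring
    refine ⟨(B - a) / b, a - (B - a) / b * a, div_nonneg (sub_nonneg.2 haB) hb, by simp, ?_, ?_⟩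
    · rw [min_eq_right hab.le]
      linarith
    · have : (B - a) / b * (p * b) = p * (B - a) := by rw [mul_left_comm, hc]
      linarith

namespace AdCell

variable {m n s : ℕ} {I : AdCell m n s}

theorem toFrac_eq_zero_or_eq_one (X : Alloc m n) (i : Fin m) (j : Fin n) :
    X.toFrac i j = 0 ∨ X.toFrac i j = 1 := by
  unfold Alloc.toFrac
  split_ifs <;> simp

theorem advDegree_toFrac (X : Alloc m n) (i : Fin m) : advDegree X.toFrac i = 0 := by
  refine (Set.ncard_eq_zero (Set.toFinite _)).2 (Set.eq_empty_of_forall_notMem fun j hj => ?_)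
  rcases toFrac_eq_zero_or_eq_one X i j with h | h
  exacts [hj.1.ne' h, hj.2.ne h]

theorem box_toFrac (X : Alloc m n) : Box X.toFrac := fun i j => by
  rcases toFrac_eq_zero_or_eq_one X i j with h | h <;> simp [h]

theorem payment_nonneg (I : AdCell m n s) {y : Frac m n} (hy : Box y) (i : Fin m) :
    0 ≤ I.payment y i :=
  Finset.sum_nonneg fun j _ => mul_nonneg (hy i j).1 (I.bid_nonneg i j)

/-- In a deterministic move no payment changes, and a Rand-Move is unbiased. -/
theorem Move.mul_payment_le_expect_bind {y : Frac m n} {μ : PMF (Frac m n)} (h : I.Move y μ)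
    {K : Frac m n → PMF (Alloc m n)} {f : Alloc m n → ℝ} {c : ℝ} {i : Fin m}
    (hK : ∀ y' ∈ μ.support, c * I.payment y' i ≤ (K y').expect f) :
    c * I.payment y i ≤ (μ.bind K).expect f := by
  cases h with
  | breakCycle z β j₀ _ _ hpay _ _ _ =>
    rw [PMF.pure_bind]
    simpa [payment_add_smul, hpay i] using hK
  | lowerTight z β k₀ _ _ hpay _ _ _ _ _ =>
    rw [PMF.pure_bind]
    simpa [payment_add_smul, hpay i] using hK
  | randMove r α β _ _ hα hβ =>
    obtain ⟨h0, h1⟩ := div_add_mem_Ioo hα.1 hβ.1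
    have hαβ : α + β ≠ 0 := (add_pos hα.1 hβ.1).ne'
    have hplus := hK (y + α • r) (mem_support_mix_left h0 (by simp))
    have hminus := hK (y - β • r) (mem_support_mix_right h1 (by simp))
    rw [payment_add_smul] at hplus
    rw [sub_eq_add_neg y, ← neg_smul, payment_add_smul, neg_smul, ← sub_eq_add_neg y] at hminus
    rw [mix_bind, PMF.pure_bind, PMF.pure_bind, expect_mix h0.le h1.le]
    calc c * I.payment y i
        = β / (α + β) * (c * (I.payment y i + α * I.payment r i)) +
          (1 - β / (α + β)) * (c * (I.payment y i + -β * I.payment r i)) := by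
          field_simp
          ring
      _ ≤ _ := add_le_add (mul_le_mul_of_nonneg_left hplus h0.le)
          (mul_le_mul_of_nonneg_left hminus (sub_nonneg.2 h1.le))

namespace Rounds

variable {y : Frac m n} {D : PMF (Alloc m n)}

theorem payment_le_expect (h : I.Rounds y D) (i : Fin m) :
    I.payment y i ≤ D.expect fun X => I.payment X.toFrac i := by
  induction h with
  | done X => exact (expect_pure X fun X => I.payment X.toFrac i).ge
  | move y μ K hμ _ ih =>
    rw [← one_mul (I.payment y i)]
    exact hμ.mul_payment_le_expect_bind fun y' hy' => (one_mul _).trans_le (ih y' hy')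

theorem apply_eq_of_not_isFrac (h : I.Rounds y D) {i : Fin m} {j : Fin n} (hij : ¬ IsFrac y i j)
    {X : Alloc m n} (hX : X ∈ D.support) : X.toFrac i j = y i j := by
  induction h with
  | done X' => rw [(PMF.mem_support_pure_iff _ _).1 hX]
  | move y μ K hμ _ ih =>
    obtain ⟨y', hy', hX⟩ := (PMF.mem_support_bind_iff _ _ _).1 hX
    have hstep : I.Step y y' := ⟨μ, hμ, hy'⟩
    rw [ih y' hy' (fun hf => hij (hstep.isFrac hf)) hX]
    obtain ⟨r, α, hr, -, rfl⟩ := hstep.exists_maxStep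
    simp [not_imp_comm.1 (hr.2 i j) hij]

theorem feasible (h : I.Rounds y D) (hy : I.Keeps y y) {X : Alloc m n} (hX : X ∈ D.support) :
    I.Feasible X := by
  induction h with
  | done X' =>
    obtain rfl := (PMF.mem_support_pure_iff _ _).1 hX
    exact ⟨hy.2.1, hy.2.2.1⟩
  | move y μ K hμ _ ih =>
    obtain ⟨y', hy', hX⟩ := (PMF.mem_support_bind_iff _ _ _).1 hX
    exact ih y' hy' (Step.keeps_self ⟨μ, hμ, hy'⟩) hX

theorem mul_payment_le_expect_of_isFrac_imp_eq (h : I.Rounds y D) (hy : Box y) {i : Fin m}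
    (hi : I.payment y i ≤ I.budget i) {j : Fin n} (hj : ∀ j', IsFrac y i j' → j' = j) {ε : ℝ}
    (hε : I.bid i j ≤ ε * I.budget i) :
    (1 - ε / 4) * I.payment y i ≤ D.expect fun X => min (I.payment X.toFrac i) (I.budget i) := by
  set a := ∑ j' ∈ Finset.univ.erase j, y i j' * I.bid i j' with ha
  have hsplit : ∀ x : Frac m n, (∀ j', j' ≠ j → x i j' = y i j') →
      I.payment x i = a + x i j * I.bid i j := fun x hx => by
    rw [payment, ← Finset.sum_erase_add _ _ (Finset.mem_univ j), ha]
    congr 1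
    exact Finset.sum_congr rfl fun j' hj' => by rw [hx j' (Finset.ne_of_mem_erase hj')]
  have hmean := hsplit y fun _ _ => rfl
  have ha0 : 0 ≤ a := Finset.sum_nonneg fun j' _ => mul_nonneg (hy i j').1 (I.bid_nonneg i j')
  obtain ⟨c, d, hc, hle0, hle1, hbound⟩ := exists_affine_le_min ha0 (I.bid_nonneg i j)
    (hy i j).1 (I.budget_pos i) hε (hmean ▸ hi)
  calc (1 - ε / 4) * I.payment y i ≤ d + c * I.payment y i := hmean ▸ hbound
    _ ≤ d + c * D.expect fun X => I.payment X.toFrac i :=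
        add_le_add_right (mul_le_mul_of_nonneg_left (h.payment_le_expect i) hc) d
    _ = D.expect fun X => d + c * I.payment X.toFrac i := (expect_const_add_mul _ _ _ _).symm
    _ ≤ D.expect fun X => min (I.payment X.toFrac i) (I.budget i) := expect_mono fun X hX => by
        rw [hsplit X.toFrac fun j' hne =>
          h.apply_eq_of_not_isFrac (fun hf => hne (hj j' hf)) hX]
        rcases toFrac_eq_zero_or_eq_one X i j with hXij | hXij
        · simpa only [hXij, zero_mul, add_zero]
        · simpa only [hXij, one_mul]

theorem mul_payment_le_expect_of_advDegree_lt_two (h : I.Rounds y D) (hy : Box y) {i : Fin m}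
    (hi : I.payment y i ≤ I.budget i) (hdeg : advDegree y i < 2) {ε : ℝ}
    (hε : ∀ j, I.bid i j ≤ ε * I.budget i) :
    (1 - ε / 4) * I.payment y i ≤ D.expect fun X => min (I.payment X.toFrac i) (I.budget i) := by
  rcases isEmpty_or_nonempty (Fin n) with hn | ⟨⟨j₀⟩⟩
  · simp [payment, PMF.expect, (I.budget_pos i).le]
  · obtain ⟨j, hj⟩ : ∃ j, ∀ j', IsFrac y i j' → j' = j := by
      have hsub : {j | IsFrac y i j}.Subsingleton :=
        Set.ncard_le_one_iff_subsingleton.1 (Nat.le_of_lt_succ hdeg)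
      by_cases hfrac : ∃ j, IsFrac y i j
      · exact hfrac.imp fun j hj j' hj' => hsub hj' hj
      · exact ⟨j₀, fun j' hj' => absurd ⟨j', hj'⟩ hfrac⟩
    exact h.mul_payment_le_expect_of_isFrac_imp_eq hy hi hj (hε j)

theorem mul_payment_le_expect (h : I.Rounds y D) (hy : I.Keeps y y) {i : Fin m}
    (hi : I.payment y i ≤ I.budget i) {ε : ℝ} (hε : ∀ j, I.bid i j ≤ ε * I.budget i) :
    (1 - ε / 4) * I.payment y i ≤ D.expect fun X => min (I.payment X.toFrac i) (I.budget i) := by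
  induction h with
  | done X =>
    refine mul_payment_le_expect_of_advDegree_lt_two (.done X) hy.1 hi ?_ hε
    simp [advDegree_toFrac]
  | move y μ K hμ hK ih =>
    rcases lt_or_ge (advDegree y i) 2 with hdeg | hdeg
    · exact mul_payment_le_expect_of_advDegree_lt_two (.move y μ K hμ hK) hy.1 hi hdeg hε
    · refine hμ.mul_payment_le_expect_bind fun y' hy' => ?_
      have hstep : I.Step y y' := ⟨μ, hμ, hy'⟩
      refine ih y' hy' hstep.keeps_self ?_
      obtain ⟨r, α, -, hα, rfl⟩ := hstep.exists_maxStep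
      exact hα.2.1.2.2.2 i hdeg

theorem mul_lpValue_le_expect_revenue (h : I.Rounds y D) (hy : I.LPFeasible y) {ε : ℝ}
    (hε : ∀ i j, I.bid i j ≤ ε * I.budget i) :
    (4 - ε) / 4 * I.lpValue y ≤ D.expect I.revenue := by
  calc (4 - ε) / 4 * I.lpValue y = ∑ i, (1 - ε / 4) * I.payment y i := by
        rw [lpValue, ← Finset.mul_sum]
        ring
    _ ≤ ∑ i, D.expect fun X => min (I.payment X.toFrac i) (I.budget i) :=
        Finset.sum_le_sum fun i _ => h.mul_payment_le_expect hy.keeps (hy.2.2.2 i) (hε i)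
    _ = D.expect I.revenue := (expect_sum _ D _).symm

theorem three_fourths_lpValue_le_expect_revenue (h : I.Rounds y D) (hy : I.LPFeasible y)
    (hbid : ∀ i j, I.bid i j ≤ I.budget i) : 3 / 4 * I.lpValue y ≤ D.expect I.revenue := by
  calc 3 / 4 * I.lpValue y = (4 - 1) / 4 * I.lpValue y := by norm_num
    _ ≤ D.expect I.revenue := h.mul_lpValue_le_expect_revenue hy (by simpa using hbid)

end Rounds

theorem bid_le_maxBidRatio_mul (I : AdCell m n s) (i : Fin m) (j : Fin n) :
    I.bid i j ≤ I.maxBidRatio * I.budget i := by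
  rw [← div_le_iff₀ (I.budget_pos i)]
  exact (le_ciSup (f := fun j => I.bid i j / I.budget i) (Set.finite_range _).bddAbove j).trans
    (le_ciSup (f := fun i => ⨆ j, I.bid i j / I.budget i) (Set.finite_range _).bddAbove i)

/-! ### The linear program bounds the integer program -/

theorem IsLPOptimal.lpOpt_eq {y : Frac m n} (h : I.IsLPOptimal y) : I.lpOpt = I.lpValue y := by
  refine IsGreatest.csSup_eq ⟨⟨y, h.1, rfl⟩, ?_⟩
  rintro _ ⟨x, hx, rfl⟩
  exact h.2 x hx

theorem LPFeasible.lpValue_le_lpOpt {x : Frac m n} (h : I.LPFeasible x) :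
    I.lpValue x ≤ I.lpOpt := by
  refine le_csSup ⟨∑ i, I.budget i, ?_⟩ ⟨x, h, rfl⟩
  rintro _ ⟨x, hx, rfl⟩
  exact Finset.sum_le_sum fun i _ => hx.2.2.2 i

/-- The solution `x` with the row of every advertiser that exceeds its budget scaled down to it.
If the payment of `i` is zero, the row becomes zero, as `budget i / 0 = 0`. -/
noncomputable def scaleToBudget (I : AdCell m n s) (x : Frac m n) : Frac m n :=
  fun i j => min 1 (I.budget i / I.payment x i) * x i j

theorem payment_scaleToBudget (I : AdCell m n s) {x : Frac m n} (hx : Box x) (i : Fin m) :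
    I.payment (I.scaleToBudget x) i = min (I.payment x i) (I.budget i) := by
  have hpay : I.payment (I.scaleToBudget x) i =
      min 1 (I.budget i / I.payment x i) * I.payment x i := by
    simp only [payment, scaleToBudget, Finset.mul_sum, mul_assoc]
  rcases (I.payment_nonneg hx i).eq_or_lt with h0 | h0
  · rw [hpay, ← h0, mul_zero, min_eq_left (I.budget_pos i).le]
  · rw [hpay, min_mul_of_nonneg _ _ h0.le, one_mul, div_mul_cancel₀ _ h0.ne']

theorem lpFeasible_scaleToBudget {x : Frac m n} (hx : Box x) (hassign : I.Assign x)
    (hcapacity : I.Capacity x) : I.LPFeasible (I.scaleToBudget x) := by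
  have hscale : ∀ i, 0 ≤ min 1 (I.budget i / I.payment x i) := fun i =>
    le_min zero_le_one (div_nonneg (I.budget_pos i).le (I.payment_nonneg hx i))
  have hle : ∀ i j, I.scaleToBudget x i j ≤ x i j := fun i j =>
    mul_le_of_le_one_left (hx i j).1 (min_le_left _ _)
  have hquery : ∀ j, queryLoad (I.scaleToBudget x) j ≤ queryLoad x j := fun j =>
    Finset.sum_le_sum fun i _ => hle i j
  refine ⟨fun i j => ⟨mul_nonneg (hscale i) (hx i j).1, (hle i j).trans (hx i j).2⟩,
    fun j => (hquery j).trans (hassign j),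
    fun k => (Finset.sum_le_sum fun j _ => hquery j).trans (hcapacity k), fun i => ?_⟩
  rw [I.payment_scaleToBudget hx]
  exact min_le_right _ _

theorem Feasible.revenue_le_lpOpt {X : Alloc m n} (h : I.Feasible X) : I.revenue X ≤ I.lpOpt :=
  calc I.revenue X = I.lpValue (I.scaleToBudget X.toFrac) :=
        Finset.sum_congr rfl fun i _ => (I.payment_scaleToBudget (box_toFrac X) i).symm
    _ ≤ I.lpOpt := (lpFeasible_scaleToBudget (box_toFrac X) h.1 h.2).lpValue_le_lpOpt

/-- An advertiser with a bid above its budget on a query allocated to it pays its whole budget,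
before and after the truncation. -/
theorem truncate_revenue (I : AdCell m n s) : I.truncate.revenue = I.revenue := by
  funext X
  refine Finset.sum_congr rfl fun i _ => ?_
  have hle : I.truncate.payment X.toFrac i ≤ I.payment X.toFrac i := Finset.sum_le_sum fun j _ =>
    mul_le_mul_of_nonneg_left (min_le_left _ _) (box_toFrac X i j).1
  change min (I.truncate.payment X.toFrac i) (I.budget i) = _
  by_cases h : ∃ j, X i j = true ∧ I.budget i < I.bid i j
  · obtain ⟨j, hX, hj⟩ := h
    have hpay : I.budget i ≤ I.truncate.payment X.toFrac i := by
      calc I.budget i = X.toFrac i j * I.truncate.bid i j := by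
            simp [Alloc.toFrac, hX, truncate, hj.le]
        _ ≤ I.truncate.payment X.toFrac i :=
            Finset.single_le_sum (f := fun j => X.toFrac i j * I.truncate.bid i j)
              (fun j _ => mul_nonneg (box_toFrac X i j).1 (I.truncate.bid_nonneg i j))
              (Finset.mem_univ j)
    rw [min_eq_right hpay, min_eq_right (hpay.trans hle)]
  · push Not at h
    congr 1
    refine Finset.sum_congr rfl fun j _ => ?_
    by_cases hX : X i j
    · simp [truncate, h j hX]
    · simp [Alloc.toFrac, hX]

theorem Feasible.revenue_le_lpOpt_truncate {X : Alloc m n} (h : I.Feasible X) :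
    I.revenue X ≤ I.truncate.lpOpt :=
  I.truncate_revenue ▸ Feasible.revenue_le_lpOpt (I := I.truncate) h

end AdCell

/-! ### Gaussian elimination -/

section Elimination

variable {V E : Type} [Fintype E] {A : V → E → ℝ} {F : Finset E} {C : Finset V} {z : E → ℝ}
  {v : V} {p : E}

/-- `z` is a nonzero vector, supported on `F`, in the kernel of the rows `C` of the matrix `A`. -/
structure IsKernelVector (A : V → E → ℝ) (F : Finset E) (C : Finset V) (z : E → ℝ) : Prop where
  ne_zero : z ≠ 0
  support : ∀ e ∉ F, z e = 0
  sum_eq_zero : ∀ v ∈ C, ∑ e, A v e * z e = 0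

/-- The matrix obtained from `A` by eliminating the variable `p` with the help of row `v`. -/
noncomputable def eliminate (A : V → E → ℝ) (v : V) (p : E) : V → E → ℝ :=
  fun u e => A u e - A u p * A v e / A v p

theorem isKernelVector_single [DecidableEq E] (A : V → E → ℝ) (hp : p ∈ F) :
    IsKernelVector A F ∅ (Pi.single p 1) where
  ne_zero := Pi.single_ne_zero_iff.2 one_ne_zero
  support e he := Pi.single_eq_of_ne (ne_of_mem_of_not_mem hp he).symm 1
  sum_eq_zero := by simp

theorem IsKernelVector.insert_of_row_eq_zero [DecidableEq V] (h : IsKernelVector A F C z)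
    (hv : ∀ e ∈ F, A v e = 0) : IsKernelVector A F (insert v C) z where
  ne_zero := h.ne_zero
  support := h.support
  sum_eq_zero := by
    refine Finset.forall_mem_insert .. |>.2 ⟨Finset.sum_eq_zero fun e _ => ?_, h.sum_eq_zero⟩
    by_cases he : e ∈ F
    · rw [hv e he, zero_mul]
    · rw [h.support e he, mul_zero]

theorem sum_mul_update_of_eq_zero [DecidableEq E] (a : E → ℝ) (hz : z p = 0) (x : ℝ) :
    ∑ e, a e * Function.update z p x e = a p * x + ∑ e, a e * z e := by
  have hupdate : Function.update z p x = Pi.single p x + z := by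
    ext e
    by_cases he : e = p
    · subst he
      simp [hz]
    · simp [he]
  simp [hupdate, mul_add, Finset.sum_add_distrib, Pi.single_apply]

theorem IsKernelVector.backSubstitute [DecidableEq E] [DecidableEq V] (hp : p ∈ F)
    (hpivot : A v p ≠ 0) (h : IsKernelVector (eliminate A v p) (F.erase p) C z) :
    IsKernelVector A F (insert v C) (Function.update z p (-(∑ e, A v e * z e) / A v p)) := by
  have hzp : z p = 0 := h.support p (Finset.notMem_erase p F)
  refine ⟨fun h0 => h.ne_zero (funext fun e => ?_), fun e he => ?_, fun u hu => ?_⟩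
  · rcases eq_or_ne e p with rfl | hne
    · exact hzp
    · simpa [hne] using congrFun h0 e
  · rw [Function.update_of_ne (ne_of_mem_of_not_mem hp he).symm]
    exact h.support e fun he' => he (Finset.mem_of_mem_erase he')
  · rw [sum_mul_update_of_eq_zero _ hzp]
    rcases Finset.mem_insert.1 hu with rfl | hu
    · rw [mul_div_cancel₀ _ hpivot, neg_add_cancel]
    · have hrow : ∑ e, eliminate A v p u e * z e =
          ∑ e, A u e * z e - A u p / A v p * ∑ e, A v e * z e := by
        rw [Finset.mul_sum, ← Finset.sum_sub_distrib]
        exact Finset.sum_congr rfl fun e _ => by unfold eliminate; ring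
      rw [← h.sum_eq_zero u hu, hrow]
      ring

end Elimination

/-! ### Programming with computation trees -/

namespace CompTree

variable {Ω R Out : Type} {inp : Ω → R → ℝ} {S : Set Ω} {K K' : Set (Ω → ℝ)} {t : ℕ}
  {G : Ω → PMF Out → Prop}

/-- A *quantity* is a function of the input `ω`. The quantity `q` is stored if, on the inputs in
`S`, it is in an input register or in one of the first `N` work registers. -/
def Stored (inp : Ω → R → ℝ) (S : Set Ω) (W : Ω → ℕ → ℝ) (N : ℕ) (q : Ω → ℝ) : Prop :=
  ∃ r : R ⊕ ℕ, (∀ k, r = .inr k → k < N) ∧ ∀ ω ∈ S, Sum.elim (inp ω) (W ω) r = q ω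

/-- Whatever the registers that hold the quantities in `K`, a computation tree of time at most `t`
has on every input in `S` an output law as demanded by `G`. -/
def Solvable (inp : Ω → R → ℝ) (S : Set Ω) (K : Set (Ω → ℝ)) (t : ℕ) (G : Ω → PMF Out → Prop) :
    Prop :=
  ∀ (W : Ω → ℕ → ℝ) (N : ℕ), (∀ q ∈ K, Stored inp S W N q) →
    ∃ T : CompTree R Out, T.time ≤ t ∧ ∀ ω ∈ S, G ω (T.runFrom (inp ω) (W ω))

/-- Knowing that the input is in `S`, and having computed the quantities in `K`, one can make at
most `c` instructions such that along each branch what is then known of the input and what is then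
computed satisfy `P`. In continuation-passing style: every task that can be solved from all such
positions can be solved from `S` and `K`. -/
def Reaches (inp : Ω → R → ℝ) (S : Set Ω) (K : Set (Ω → ℝ)) (c : ℕ)
    (P : Set Ω → Set (Ω → ℝ) → Prop) : Prop :=
  ∀ (Out : Type) [Nonempty Out] (t : ℕ) (G : Ω → PMF Out → Prop),
    (∀ S' ⊆ S, S'.Nonempty → ∀ K' ⊇ K, P S' K' → Solvable inp S' K' t G) →
      Solvable inp S K (t + c) G

theorem Stored.mono_inputs {W : Ω → ℕ → ℝ} {N : ℕ} {q : Ω → ℝ} {S' : Set Ω}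
    (h : Stored inp S W N q) (hS' : S' ⊆ S) : Stored inp S' W N q :=
  let ⟨r, hr, hq⟩ := h
  ⟨r, hr, fun ω hω => hq ω (hS' hω)⟩

theorem Stored.update {W : Ω → ℕ → ℝ} {N : ℕ} {q : Ω → ℝ} (h : Stored inp S W N q)
    (x : Ω → ℝ) : Stored inp S (fun ω => Function.update (W ω) N (x ω)) (N + 1) q := by
  obtain ⟨r, hr, hq⟩ := h
  refine ⟨r, fun k hk => (hr k hk).trans (Nat.lt_succ_self N), fun ω hω => ?_⟩
  rw [← hq ω hω]
  rcases r with r | k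
  · rfl
  · simp [Function.update_of_ne (hr k rfl).ne]

theorem stored_update_of_mem_insert {W : Ω → ℕ → ℝ} {N : ℕ} {x q : Ω → ℝ}
    (hK : ∀ q ∈ K, Stored inp S W N q) (hq : q ∈ insert x K) :
    Stored inp S (fun ω => Function.update (W ω) N (x ω)) (N + 1) q := by
  rcases Set.mem_insert_iff.1 hq with rfl | hq
  · exact ⟨.inr N, fun k hk => by cases hk; exact Nat.lt_succ_self N, fun ω _ => by simp⟩
  · exact (hK q hq).update x

namespace Solvable

theorem mono_time {t' : ℕ} (h : Solvable inp S K t G) (htt' : t ≤ t') : Solvable inp S K t' G :=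
  fun W N hK => let ⟨T, hT, hG⟩ := h W N hK; ⟨T, hT.trans htt', hG⟩

theorem mono_goal {G' : Ω → PMF Out → Prop} (h : Solvable inp S K t G)
    (hG : ∀ ω ∈ S, ∀ D, G ω D → G' ω D) : Solvable inp S K t G' :=
  fun W N hK => let ⟨T, hT, hT'⟩ := h W N hK; ⟨T, hT, fun ω hω => hG ω hω _ (hT' ω hω)⟩

theorem output (o : Out) (h : ∀ ω ∈ S, G ω (PMF.pure o)) : Solvable inp S K t G :=
  fun _ _ _ => ⟨.output o, Nat.zero_le _, h⟩

theorem of_nonempty [Nonempty Out] (h : S.Nonempty → Solvable inp S K t G) :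
    Solvable inp S K t G := by
  rcases S.eq_empty_or_nonempty with rfl | hS
  · exact output (Classical.arbitrary Out) fun _ h => h.elim
  · exact h hS

theorem coin {p : Ω → ℝ} (hp : p ∈ K) {G₁ G₂ : Ω → PMF Out → Prop}
    (h₁ : Solvable inp S K t G₁) (h₂ : Solvable inp S K t G₂)
    (h : ∀ ω ∈ S, ∀ D₁ D₂, G₁ ω D₁ → G₂ ω D₂ → G ω (PMF.mix (p ω) D₁ D₂)) :
    Solvable inp S K (t + 1) G := by
  intro W N hK
  obtain ⟨r, -, hr⟩ := hK p hp
  obtain ⟨T₁, ht₁, h₁⟩ := h₁ W N hK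
  obtain ⟨T₂, ht₂, h₂⟩ := h₂ W N hK
  refine ⟨.coin r T₁ T₂, Nat.succ_le_succ (max_le ht₁ ht₂), fun ω hω => ?_⟩
  simp only [runFrom, hr ω hω]
  exact h ω hω _ _ (h₁ ω hω) (h₂ ω hω)

end Solvable

/-- The quantity `q` is the value of an arithmetic expression of size at most `c` in the quantities
of `K`. -/
inductive Cost (K : Set (Ω → ℝ)) : (Ω → ℝ) → ℕ → Prop
  | mem {q : Ω → ℝ} : q ∈ K → Cost K q 0
  | op (o : ArithOp) {a b : Ω → ℝ} {c d : ℕ} : Cost K a c → Cost K b d →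
      Cost K (fun ω => o.eval (a ω) (b ω)) (c + d + 1)
  | weaken {q : Ω → ℝ} {c d : ℕ} : Cost K q c → c ≤ d → Cost K q d

namespace Cost

variable {a b : Ω → ℝ} {c d : ℕ}

theorem mono {q : Ω → ℝ} (h : Cost K q c) (hK : K ⊆ K') : Cost K' q c := by
  induction h with
  | mem h => exact .mem (hK h)
  | op o _ _ iha ihb => exact .op o iha ihb
  | weaken _ hcd ih => exact .weaken ih hcd

theorem add (ha : Cost K a c) (hb : Cost K b d) : Cost K (fun ω => a ω + b ω) (c + d + 1) :=
  .op .add ha hb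

theorem sub (ha : Cost K a c) (hb : Cost K b d) : Cost K (fun ω => a ω - b ω) (c + d + 1) :=
  .op .sub ha hb

theorem mul (ha : Cost K a c) (hb : Cost K b d) : Cost K (fun ω => a ω * b ω) (c + d + 1) :=
  .op .mul ha hb

theorem div (ha : Cost K a c) (hb : Cost K b d) : Cost K (fun ω => a ω / b ω) (c + d + 1) :=
  .op .div ha hb

theorem neg (h0 : (fun _ => 0) ∈ K) (ha : Cost K a c) : Cost K (fun ω => -a ω) (c + 1) := by
  simpa only [zero_sub, zero_add] using (Cost.mem h0).sub ha

theorem sum {ι : Type*} (t : Finset ι) {f : ι → Ω → ℝ} (h0 : (fun _ => 0) ∈ K)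
    (h : ∀ i ∈ t, Cost K (f i) c) : Cost K (fun ω => ∑ i ∈ t, f i ω) (t.card * (c + 1)) := by
  classical
  induction t using Finset.induction_on with
  | empty => simpa using Cost.mem h0
  | insert i t hi ih =>
    have hsum := (h i (Finset.mem_insert_self i t)).add
      (ih fun i' hi' => h i' (Finset.mem_insert_of_mem hi'))
    simp only [Finset.sum_insert hi, Finset.card_insert_of_notMem hi]
    exact hsum.weaken (by ring_nf; rfl)

end Cost

namespace Reaches

variable {P Q : Set Ω → Set (Ω → ℝ) → Prop} {c d : ℕ}

theorem refl (h : P S K) : Reaches inp S K 0 P :=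
  fun _ _ _ _ hnext => .of_nonempty fun hS => hnext S subset_rfl hS K subset_rfl h

theorem trans (h : Reaches inp S K c P)
    (hnext : ∀ S' ⊆ S, S'.Nonempty → ∀ K' ⊇ K, P S' K' → Reaches inp S' K' d Q) :
    Reaches inp S K (c + d) Q := by
  intro Out _ t G hG
  rw [add_comm c, ← add_assoc]
  exact h Out _ G fun S' hS' hne K' hK' hP => hnext S' hS' hne K' hK' hP Out t G
    fun S'' hS'' hne' K'' hK'' => hG S'' (hS''.trans hS') hne' K'' (hK'.trans hK'')

theorem mono (h : Reaches inp S K c P) (hcd : c ≤ d)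
    (hPQ : ∀ S' ⊆ S, S'.Nonempty → ∀ K' ⊇ K, P S' K' → Q S' K') : Reaches inp S K d Q :=
  fun Out _ t G hG => (h Out t G fun S' hS' hne K' hK' hP =>
    hG S' hS' hne K' hK' (hPQ S' hS' hne K' hK' hP)).mono_time (Nat.add_le_add_left hcd t)

theorem inputs : Reaches inp S K 0 fun _ K' => ∀ r, (fun ω => inp ω r) ∈ K' := by
  refine fun Out _ t G hG => .of_nonempty fun hS W N hK => ?_
  refine hG S subset_rfl hS (K ∪ Set.range fun r ω => inp ω r) Set.subset_union_left
    (fun r => .inr ⟨r, rfl⟩) W N ?_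
  rintro q (hq | ⟨r, rfl⟩)
  · exact hK q hq
  · exact ⟨.inl r, by simp, fun _ _ => rfl⟩

theorem one : Reaches inp S K 1 fun _ K' => (fun _ => 1) ∈ K' := by
  refine fun Out _ t G hG => .of_nonempty fun hS W N hK => ?_
  obtain ⟨T, hT, hTG⟩ := hG S subset_rfl hS _ (Set.subset_insert (fun _ => 1) K)
    (Set.mem_insert _ _) _ _ fun q => stored_update_of_mem_insert hK
  exact ⟨.one N T, Nat.succ_le_succ hT, hTG⟩

theorem arith (o : ArithOp) {a b : Ω → ℝ} (ha : a ∈ K) (hb : b ∈ K) :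
    Reaches inp S K 1 fun _ K' => (fun ω => o.eval (a ω) (b ω)) ∈ K' := by
  refine fun Out _ t G hG => .of_nonempty fun hS W N hK => ?_
  obtain ⟨T, hT, hTG⟩ := hG S subset_rfl hS _ (Set.subset_insert (fun ω => o.eval (a ω) (b ω)) K)
    (Set.mem_insert _ _) _ _ fun q => stored_update_of_mem_insert hK
  obtain ⟨ra, -, hra⟩ := hK a ha
  obtain ⟨rb, -, hrb⟩ := hK b hb
  refine ⟨.arith N o ra rb T, Nat.succ_le_succ hT, fun ω hω => ?_⟩
  simp only [runFrom, hra ω hω, hrb ω hω]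
  exact hTG ω hω

theorem compare {a b : Ω → ℝ} (ha : a ∈ K) (hb : b ∈ K) :
    Reaches inp S K 1 fun S' _ => (∀ ω ∈ S', a ω ≤ b ω) ∨ ∀ ω ∈ S', b ω < a ω := by
  intro Out _ t G hG W N hK
  obtain ⟨ra, -, hra⟩ := hK a ha
  obtain ⟨rb, -, hrb⟩ := hK b hb
  have hsub : ∀ S' ⊆ S, ((∀ ω ∈ S', a ω ≤ b ω) ∨ ∀ ω ∈ S', b ω < a ω) →
      ∃ T : CompTree R Out, T.time ≤ t ∧ ∀ ω ∈ S', G ω (T.runFrom (inp ω) (W ω)) := fun S' hS' h =>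
    Solvable.of_nonempty (fun hne => hG S' hS' hne K subset_rfl h) W N
      fun q hq => (hK q hq).mono_inputs hS'
  obtain ⟨T₁, ht₁, h₁⟩ := hsub {ω ∈ S | a ω ≤ b ω} (fun _ h => h.1) (.inl fun _ h => h.2)
  obtain ⟨T₂, ht₂, h₂⟩ := hsub {ω ∈ S | b ω < a ω} (fun _ h => h.1) (.inr fun _ h => h.2)
  refine ⟨.branch ra rb T₁ T₂, Nat.succ_le_succ (max_le ht₁ ht₂), fun ω hω => ?_⟩
  simp only [runFrom, hra ω hω, hrb ω hω]
  split_ifs with hle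
  · exact h₁ ω ⟨hω, hle⟩
  · exact h₂ ω ⟨hω, not_le.1 hle⟩

theorem compare_all {ι : Type*} [Fintype ι] {a b : ι → Ω → ℝ} (ha : ∀ i, a i ∈ K)
    (hb : ∀ i, b i ∈ K) : Reaches inp S K (Fintype.card ι) fun S' _ =>
      ∀ ω ∈ S', ∀ ω' ∈ S', ∀ i, a i ω ≤ b i ω ↔ a i ω' ≤ b i ω' := by
  classical
  suffices h : ∀ A : Finset ι, Reaches inp S K A.card fun S' _ =>
      ∀ ω ∈ S', ∀ ω' ∈ S', ∀ i ∈ A, a i ω ≤ b i ω ↔ a i ω' ≤ b i ω' by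
    simpa using h Finset.univ
  intro A
  induction A using Finset.induction_on with
  | empty => exact .refl (by simp)
  | insert i A hi ih =>
    rw [Finset.card_insert_of_notMem hi]
    refine ih.trans fun S' _ _ K' hK' hA => (compare (hK' (ha i)) (hK' (hb i))).mono le_rfl ?_
    intro S'' hS'' _ _ _ hcases ω hω ω' hω'
    refine Finset.forall_mem_insert .. |>.2 ⟨?_, hA ω (hS'' hω) ω' (hS'' hω')⟩
    rcases hcases with hle | hlt
    · exact iff_of_true (hle ω hω) (hle ω' hω')
    · exact iff_of_false (hlt ω hω).not_ge (hlt ω' hω').not_ge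

theorem cost {q : Ω → ℝ} (hq : Cost K q c) : Reaches inp S K c fun _ K' => q ∈ K' := by
  suffices h : ∀ {S K'}, K ⊆ K' → Reaches inp S K' c fun _ K'' => q ∈ K'' from h subset_rfl
  induction hq with
  | mem hq => exact fun hK => .refl (hK hq)
  | op o _ _ iha ihb =>
    exact fun hK => ((iha hK).trans fun _ _ _ _ hK₁ ha => (ihb (hK.trans hK₁)).trans
      fun _ _ _ _ hK₂ hb => arith o (hK₂ ha) hb).mono (add_assoc ..).ge fun _ _ _ _ _ h => h
  | weaken _ hcd ih => exact fun hK => (ih hK).mono hcd fun _ _ _ _ _ h => h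

theorem cost_all {ι : Type*} [Fintype ι] {q : ι → Ω → ℝ} (hq : ∀ i, Cost K (q i) c) :
    Reaches inp S K (Fintype.card ι * c) fun _ K' => ∀ i, q i ∈ K' := by
  classical
  suffices h : ∀ A : Finset ι, Reaches inp S K (A.card * c) fun _ K' => ∀ i ∈ A, q i ∈ K' by
    simpa using h Finset.univ
  intro A
  induction A using Finset.induction_on with
  | empty => exact (refl (P := fun _ _ => True) trivial).mono (Nat.zero_le _) (by simp)
  | insert i A hi ih =>
    rw [Finset.card_insert_of_notMem hi, Nat.succ_mul]
    refine ih.trans fun S' _ _ K' hK' hA => (cost ((hq i).mono hK')).mono le_rfl ?_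
    exact fun _ _ _ K'' hK'' hqi =>
      Finset.forall_mem_insert .. |>.2 ⟨hqi, fun i hi => hK'' (hA i hi)⟩

theorem compare_zero {ι : Type*} [Fintype ι] {a : ι → Ω → ℝ} (h0 : (fun _ => 0) ∈ K)
    (ha : ∀ i, a i ∈ K) : Reaches inp S K (2 * Fintype.card ι) fun S' _ =>
      ∀ ω ∈ S', ∀ ω' ∈ S', ∀ i, a i ω = 0 ↔ a i ω' = 0 := by
  rw [two_mul]
  refine (compare_all ha fun _ => h0).trans fun S' _ _ K' hK' hle => ?_
  refine (compare_all (fun _ => hK' h0) fun i => hK' (ha i)).mono le_rfl ?_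
  intro S'' hS'' _ _ _ hge ω hω ω' hω' i
  rw [le_antisymm_iff, le_antisymm_iff, hle ω (hS'' hω) ω' (hS'' hω'), hge ω hω ω' hω']

end Reaches

section Kernel

variable {E V : Type} [Fintype E] {A : V → E → Ω → ℝ} {F : Finset E} {C : Finset V}

/-- A vector as in `IsKernelVector`, for a matrix of quantities, is among the quantities `K`. -/
def KnowsKernelVector (A : V → E → Ω → ℝ) (F : Finset E) (C : Finset V) (S : Set Ω)
    (K : Set (Ω → ℝ)) : Prop :=
  ∃ z : E → Ω → ℝ, (∀ e, z e ∈ K) ∧ ∀ ω ∈ S, IsKernelVector (fun v e => A v e ω) F C fun e => z e ω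

theorem knowsKernelVector_empty (hF : F.Nonempty) (h0 : (fun _ => 0) ∈ K)
    (h1 : (fun _ => 1) ∈ K) : KnowsKernelVector A F ∅ S K := by
  classical
  obtain ⟨p, hp⟩ := hF
  refine ⟨fun e _ => (Pi.single p 1 : E → ℝ) e, fun e => ?_,
    fun ω _ => isKernelVector_single _ hp⟩
  rcases eq_or_ne e p with rfl | hne
  · simpa using h1
  · simpa [hne] using h0

theorem KnowsKernelVector.reaches_backSubstitute [DecidableEq E] [DecidableEq V] {v : V} {p : E}
    (hpF : p ∈ F) (hpivot : ∀ ω ∈ S, A v p ω ≠ 0) (h0 : (fun _ => 0) ∈ K) (hA : ∀ e, A v e ∈ K)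
    (h : KnowsKernelVector (fun u e ω => eliminate (fun u e => A u e ω) v p u e) (F.erase p) C
      S K) :
    Reaches inp S K (2 * Fintype.card E + 2) (KnowsKernelVector A F (insert v C)) := by
  obtain ⟨z, hzK, hz⟩ := h
  have hsum : Cost K (fun ω => ∑ e, A v e ω * z e ω) (Fintype.card E * 2) :=
    Cost.sum Finset.univ h0 fun e _ => (Cost.mem (hA e)).mul (Cost.mem (hzK e))
  have hvalue : Cost K (fun ω => -(∑ e, A v e ω * z e ω) / A v p ω) (2 * Fintype.card E + 2) :=
    ((hsum.neg h0).div (Cost.mem (hA p))).weaken (by omega)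
  refine (Reaches.cost hvalue).mono le_rfl fun S' hS' _ K' hK' hq => ?_
  refine ⟨fun e ω => Function.update (fun e => z e ω) p (-(∑ e, A v e ω * z e ω) / A v p ω) e,
    fun e => ?_, fun ω hω => (hz ω (hS' hω)).backSubstitute hpF (hpivot ω (hS' hω))⟩
  rcases eq_or_ne e p with rfl | hne
  · simpa using hq
  · simpa [hne] using hK' (hzK e)

/-- The time to eliminate one variable and to compute its value afterwards. -/
def eliminationTime (V E : Type) [Fintype V] [Fintype E] : ℕ :=
  3 * (Fintype.card V * Fintype.card E) + 4 * Fintype.card E + 2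

theorem reaches_knowsKernelVector [Fintype V] (hcard : C.card < F.card) (h0 : (fun _ => 0) ∈ K)
    (h1 : (fun _ => 1) ∈ K) (hA : ∀ v e, A v e ∈ K) :
    Reaches inp S K (C.card * eliminationTime V E) (KnowsKernelVector A F C) := by
  classical
  induction C using Finset.induction_on generalizing S K F A with
  | empty =>
    rw [Finset.card_empty, zero_mul]
    exact .refl (knowsKernelVector_empty (Finset.card_pos.1 hcard) h0 h1)
  | insert v C hv ih =>
    rw [Finset.card_insert_of_notMem hv] at hcard ⊢
    suffices h : ∀ S' ⊆ S, S'.Nonempty → ∀ K' ⊇ K,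
        (∀ ω ∈ S', ∀ ω' ∈ S', ∀ e, A v e ω = 0 ↔ A v e ω' = 0) →
        Reaches inp S' K' (3 * (Fintype.card V * Fintype.card E) +
          (C.card * eliminationTime V E + (2 * Fintype.card E + 2)))
          (KnowsKernelVector A F (insert v C)) from
      ((Reaches.compare_zero h0 (hA v)).trans h).mono
        (by unfold eliminationTime; ring_nf; rfl) fun _ _ _ _ _ h => h
    rintro S' - ⟨ω₀, hω₀⟩ K' hK' hconst
    by_cases hrow : ∀ e ∈ F, A v e ω₀ = 0
    · refine (ih (F := F) (by omega) (hK' h0) (hK' h1) fun u e => hK' (hA u e)).mono (by omega) ?_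
      exact fun S'' hS'' _ K'' _ ⟨z, hzK, hz⟩ => ⟨z, hzK, fun ω hω =>
        (hz ω hω).insert_of_row_eq_zero fun e he =>
          (hconst ω (hS'' hω) ω₀ hω₀ e).2 (hrow e he)⟩
    · push Not at hrow
      obtain ⟨p, hpF, hp₀⟩ := hrow
      have hpivot : ∀ ω ∈ S', A v p ω ≠ 0 := fun ω hω h => hp₀ ((hconst ω hω ω₀ hω₀ p).1 h)
      have hcost : ∀ ue : V × E,
          Cost K' (fun ω => eliminate (fun u e => A u e ω) v p ue.1 ue.2) 3 := fun ue =>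
        (Cost.mem (hK' (hA ue.1 ue.2))).sub (((Cost.mem (hK' (hA ue.1 p))).mul
          (Cost.mem (hK' (hA v ue.2)))).div (Cost.mem (hK' (hA v p))))
      have hmatrix := Reaches.cost_all (inp := inp) (S := S') hcost
      rw [Fintype.card_prod, mul_comm _ 3] at hmatrix
      refine hmatrix.trans fun S₁ hS₁ _ K₁ hK₁ hA₁ => (ih (F := F.erase p)
        (by rw [Finset.card_erase_of_mem hpF]; omega) (hK₁ (hK' h0)) (hK₁ (hK' h1))
        fun u e => hA₁ (u, e)).trans fun S₂ hS₂ _ K₂ hK₂ h => ?_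
      exact h.reaches_backSubstitute hpF (fun ω hω => hpivot ω (hS₁ (hS₂ hω)))
        (hK₂ (hK₁ (hK' h0))) fun e => hK₂ (hK₁ (hK' (hA v e)))

end Kernel

theorem Reaches.ratioTest {ι : Type} [Fintype ι] {a b : ι → Ω → ℝ} (act : ι → Prop)
    (h0 : (fun _ => 0) ∈ K) (ha : ∀ c, a c ∈ K) (hb : ∀ c, b c ∈ K)
    (hex : ∀ ω ∈ S, ∃ c, act c ∧ 0 < b c ω) :
    Reaches inp S K (Fintype.card ι * Fintype.card ι + 2 * Fintype.card ι) fun S' K' =>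
      ∃ α ∈ K', ∀ ω ∈ S',
        IsLeast {x | ∃ c, (act c ∧ 0 < b c ω) ∧ a c ω / b c ω = x} (α ω) := by
  classical
  have hquotients := cost_all (inp := inp) (S := S)
    fun c => (Cost.mem (ha c)).div (Cost.mem (hb c))
  suffices h : ∀ S' ⊆ S, ∀ K' ⊇ K, (∀ c, (fun ω => a c ω / b c ω) ∈ K') →
      Reaches inp S' K' (Fintype.card ι + Fintype.card (ι × ι)) fun S' K' => ∃ α ∈ K', ∀ ω ∈ S',
        IsLeast {x | ∃ c, (act c ∧ 0 < b c ω) ∧ a c ω / b c ω = x} (α ω) from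
    (hquotients.trans fun S' hS' _ => h S' hS').mono (by rw [Fintype.card_prod]; omega)
      fun _ _ _ _ _ h => h
  intro S₁ hS₁ K₁ hK₁ hquot
  refine (compare_all (fun c => hK₁ (hb c)) fun _ => hK₁ h0).trans fun S₂ hS₂ _ K₂ hK₂ hsign => ?_
  refine (compare_all (ι := ι × ι) (fun cc => hK₂ (hquot cc.1)) fun cc => hK₂ (hquot cc.2)).mono
    le_rfl fun S₃ hS₃ ⟨ω₀, hω₀⟩ K₃ hK₃ horder => ?_
  have hpos : ∀ ω ∈ S₃, ∀ c, 0 < b c ω ↔ 0 < b c ω₀ := fun ω hω c => by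
    simpa using not_congr (hsign ω (hS₃ hω) ω₀ (hS₃ hω₀) c)
  obtain ⟨c₁, hc₁⟩ := hex ω₀ (hS₁ (hS₂ (hS₃ hω₀)))
  obtain ⟨c₀, hc₀, hmin⟩ := Finset.exists_min_image {c | act c ∧ 0 < b c ω₀}
    (fun c => a c ω₀ / b c ω₀) ⟨c₁, by simpa using hc₁⟩
  simp only [Finset.mem_filter_univ] at hc₀ hmin
  refine ⟨_, hK₃ (hK₂ (hquot c₀)), fun ω hω =>
    ⟨⟨c₀, ⟨hc₀.1, (hpos ω hω c₀).2 hc₀.2⟩, rfl⟩, ?_⟩⟩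
  rintro _ ⟨c, ⟨hact, hbc⟩, rfl⟩
  exact (horder ω hω ω₀ hω₀ (c₀, c)).2 (hmin c ⟨hact, (hpos ω hω c).1 hbc⟩)

end CompTree

/-! ### The rounding as a computation tree -/

namespace AdCell

open CompTree

variable {m n s : ℕ}

theorem Rounds.of_pure {I : AdCell m n s} {y y' : Frac m n} {D : PMF (Alloc m n)}
    (h : I.Move y (PMF.pure y')) (h' : I.Rounds y' D) : I.Rounds y D := by
  simpa using Rounds.move y _ (fun _ => D) h (by simpa using h')

theorem Rounds.of_mix {I : AdCell m n s} {y y₁ y₂ : Frac m n} {p : ℝ} {D₁ D₂ : PMF (Alloc m n)}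
    (h : I.Move y (PMF.mix p (PMF.pure y₁) (PMF.pure y₂))) (hne : y₁ ≠ y₂)
    (h₁ : I.Rounds y₁ D₁) (h₂ : I.Rounds y₂ D₂) : I.Rounds y (PMF.mix p D₁ D₂) := by
  classical
  have hbind := Rounds.move y _ (fun y' => if y' = y₁ then D₁ else D₂) h fun y' hy' => by
    by_cases hy₁ : y' = y₁
    · simpa [hy₁] using h₁
    · by_cases hy₂ : y' = y₂
      · simpa [hy₂, hne.symm] using h₂
      · simp [mix_apply, hy₁, hy₂] at hy'
  simpa [mix_bind, hne.symm] using hbind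

theorem add_smul_ne_sub_smul {E : Type*} [AddCommGroup E] [Module ℝ E] {y z : E} {α β : ℝ}
    (hαβ : α + β ≠ 0) (hz : z ≠ 0) : y + α • z ≠ y - β • z := by
  intro h
  have hzero : (α + β) • z = 0 := by
    rw [add_smul, ← eq_neg_iff_add_eq_zero]
    exact add_left_cancel (h.trans (sub_eq_add_neg ..))
  exact smul_ne_zero hαβ hz hzero

theorem exists_slope_pos (I : AdCell m n s) (y : Frac m n) {r : Frac m n} (hr : r ≠ 0) :
    ∃ c, ActiveIneq y c ∧ 0 < I.slope r c := by
  obtain ⟨i, hi⟩ := Function.ne_iff.1 hr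
  obtain ⟨j, hij⟩ := Function.ne_iff.1 hi
  rcases lt_or_gt_of_ne hij with hneg | hpos
  · exact ⟨.inl (i, j), trivial, neg_pos.2 hneg⟩
  · exact ⟨.inr (.inl (i, j)), trivial, hpos⟩

theorem activeIneq_congr {y y' : Frac m n} (h : IsFrac y = IsFrac y') (c : Ineq m n s) :
    ActiveIneq y c ↔ ActiveIneq y' c := by
  rcases c with _ | _ | _ | _ <;> simp [ActiveIneq, Active, advDegree, h]

theorem pattern_eq_of_comparisons {I I' : AdCell m n s} {y y' : Frac m n} (hy : I.Keeps y y)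
    (hy' : I'.Keeps y' y') (hzero : ∀ i j, y i j ≤ 0 ↔ y' i j ≤ 0)
    (hone : ∀ i j, 1 ≤ y i j ↔ 1 ≤ y' i j)
    (hload : ∀ v, I.bound v ≤ I.load y v ↔ I'.bound v ≤ I'.load y' v)
    (hcustomer : I.customer = I'.customer) : I.pattern y = I'.pattern y' := by
  simp only [pattern, Pattern.mk.injEq]
  refine ⟨hcustomer, ?_, funext fun j => propext ?_, funext fun k => propext ?_⟩
  · ext i j
    simp only [IsFrac, ← not_le, hzero, hone]
  · exact (hy.2.1 j).ge_iff_eq.symm.trans <| (hload (.inr (.inl j))).trans (hy'.2.1 j).ge_iff_eq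
  · exact (hy.2.2.1 k).ge_iff_eq.symm.trans <|
      (hload (.inr (.inr k))).trans (hy'.2.2.1 k).ge_iff_eq

/-- The inputs of the rounding: an instance and a fractional solution. -/
abbrev RoundingInput (m n s : ℕ) : Type := AdCell m n s × Frac m n

/-- The contents of the input registers. -/
noncomputable def registers (ω : RoundingInput m n s) : InputReg m n s → ℝ := ω.1.input ω.2

/-- The quantities in `K` comprise the input and the constants `0` and `1`. -/
structure KnowsInput (K : Set (RoundingInput m n s → ℝ)) : Prop where
  zero : (fun _ => 0) ∈ K
  one : (fun _ => 1) ∈ K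
  registers : ∀ r, (fun ω => registers ω r) ∈ K

/-- The entries of the matrix `Y`, which depends on the input, are among the quantities in `K`. -/
def Knows (K : Set (RoundingInput m n s → ℝ)) (Y : RoundingInput m n s → Frac m n) : Prop :=
  ∀ i j, (fun ω => Y ω i j) ∈ K

variable {S : Set (RoundingInput m n s)} {K K' : Set (RoundingInput m n s → ℝ)}
  {Y Z : RoundingInput m n s → Frac m n} {F : Finset (Fin m × Fin n)} {C : Finset (Row m n s)}

theorem KnowsInput.mono (h : KnowsInput K) (hK : K ⊆ K') : KnowsInput K' :=
  ⟨hK h.zero, hK h.one, fun r => hK (h.registers r)⟩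

theorem Knows.mono (h : Knows K Y) (hK : K ⊆ K') : Knows K' Y := fun i j => hK (h i j)

theorem KnowsInput.coef_mem (h : KnowsInput K) (v : Row m n s) (e : Fin m × Fin n) :
    (fun ω => ω.1.coef v e) ∈ K := by
  rcases v with i | j | k
  · by_cases he : e.1 = i
    · simpa [coef, he, AdCell.registers, input] using h.registers (.bid i e.2)
    · simpa [coef, he] using h.zero
  · by_cases he : e.2 = j
    · simpa [coef, he] using h.one
    · simpa [coef, he] using h.zero
  · exact h.registers (.customer e.2 k)

theorem KnowsInput.bound_mem (h : KnowsInput K) (v : Row m n s) :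
    (fun ω => ω.1.bound v) ∈ K := by
  rcases v with i | j | k
  · exact h.registers (.budget i)
  · exact h.registers (.arrival j)
  · exact h.registers (.capacity k)

theorem Knows.cost_load (hY : Knows K Y) (hK : KnowsInput K) (v : Row m n s) :
    Cost K (fun ω => ω.1.load (Y ω) v) (2 * (m * n)) := by
  have hsum := Cost.sum Finset.univ hK.zero fun (e : Fin m × Fin n) _ =>
    (Cost.mem (hK.coef_mem v e)).mul (Cost.mem (hY e.1 e.2))
  simp only [← load_eq_sum, Finset.card_univ, Fintype.card_prod, Fintype.card_fin] at hsum
  exact hsum.weaken (mul_comm ..).le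

theorem Knows.cost_slope (hZ : Knows K Z) (hK : KnowsInput K) (c : Ineq m n s) :
    Cost K (fun ω => ω.1.slope (Z ω) c) (2 * (m * n) + 1) := by
  rcases c with e | e | v
  · exact ((Cost.mem (hZ e.1 e.2)).neg hK.zero).weaken (by omega)
  · exact (Cost.mem (hZ e.1 e.2)).weaken (by omega)
  · exact (hZ.cost_load hK v).weaken (by omega)

theorem Knows.cost_slack (hY : Knows K Y) (hK : KnowsInput K) (c : Ineq m n s) :
    Cost K (fun ω => ω.1.slack (Y ω) c) (2 * (m * n) + 1) := by
  rcases c with e | e | v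
  · exact (Cost.mem (hY e.1 e.2)).weaken (by omega)
  · exact ((Cost.mem hK.one).sub (Cost.mem (hY e.1 e.2))).weaken (by omega)
  · exact ((Cost.mem (hK.bound_mem v)).sub (hY.cost_load hK v)).weaken (by omega)

theorem reaches_knows {c : ℕ} (hY : ∀ i j, Cost K (fun ω => Y ω i j) c) :
    Reaches registers S K (m * n * c) fun _ K' => Knows K' Y := by
  have hentries := Reaches.cost_all (inp := registers) (S := S) fun e : Fin m × Fin n => hY e.1 e.2
  exact hentries.mono (by simp) fun _ _ _ _ _ h i j => h (i, j)

theorem reaches_knows_neg (hK : KnowsInput K) (hZ : Knows K Z) :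
    Reaches registers S K (m * n) fun _ K' => Knows K' fun ω => -Z ω :=
  (reaches_knows fun i j => (Cost.mem (hZ i j)).neg hK.zero).mono (by simp) fun _ _ _ _ _ h => h

/-- The time to compute the length of a maximal step and the solution it leads to. -/
def maxStepTime (m n s : ℕ) : ℕ :=
  Fintype.card (Ineq m n s) * (2 * (m * n) + 1) + (Fintype.card (Ineq m n s) * (2 * (m * n) + 1) +
    (Fintype.card (Ineq m n s) * Fintype.card (Ineq m n s) + 2 * Fintype.card (Ineq m n s) +
      m * n * 2))

theorem reaches_maxStep (hK : KnowsInput K) (hY : Knows K Y) (hZ : Knows K Z)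
    (hfrac : ∀ ω ∈ S, ∀ ω' ∈ S, IsFrac (Y ω) = IsFrac (Y ω'))
    (hkeeps : ∀ ω ∈ S, ω.1.Keeps (Y ω) (Y ω)) (hne : ∀ ω ∈ S, Z ω ≠ 0)
    (hallows : ∀ ω ∈ S, ω.1.Allows (Y ω) (Z ω)) :
    Reaches registers S K (maxStepTime m n s) fun S' K' => ∃ α ∈ K',
      Knows K' (fun ω => Y ω + α ω • Z ω) ∧ ∀ ω ∈ S', ω.1.MaxStep (Y ω) (Z ω) (α ω) := by
  refine (Reaches.cost_all (hY.cost_slack hK)).trans fun S₁ hS₁ _ K₁ hK₁ hslack => ?_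
  refine (Reaches.cost_all ((hZ.mono hK₁).cost_slope (hK.mono hK₁))).trans
    fun S₂ hS₂ ⟨ω₀, hω₀⟩ K₂ hK₂ hslope => ?_
  refine (Reaches.ratioTest (ActiveIneq (Y ω₀)) (hK₂ (hK₁ hK.zero)) (fun c => hK₂ (hslack c)) hslope
    fun ω hω => ω.1.exists_slope_pos _ (hne ω (hS₁ (hS₂ hω)))).trans
      fun S₃ hS₃ _ K₃ hK₃ ⟨α, hα, hleast⟩ => ?_
  have hK₀₃ : K ⊆ K₃ := (hK₁.trans hK₂).trans hK₃
  refine (reaches_knows fun i j => (Cost.mem (hK₀₃ (hY i j))).add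
    ((Cost.mem hα).mul (Cost.mem (hK₀₃ (hZ i j))))).mono le_rfl
      fun S₄ hS₄ _ K₄ hK₄ hnext => ⟨α, hK₄ hα, hnext, fun ω hω => ?_⟩
  have hS₀₄ : ∀ ω ∈ S₄, ω ∈ S := fun ω hω => hS₁ (hS₂ (hS₃ (hS₄ hω)))
  refine ω.1.maxStep_of_isLeast_ratio (hkeeps ω (hS₀₄ ω hω)) (hallows ω (hS₀₄ ω hω)) ?_
  simpa only [activeIneq_congr (hfrac ω₀ (hS₁ (hS₂ hω₀)) ω (hS₀₄ ω hω))] using hleast ω (hS₄ hω)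

theorem reaches_maxStep_both (hK : KnowsInput K) (hY : Knows K Y) (hZ : Knows K Z)
    (hfrac : ∀ ω ∈ S, ∀ ω' ∈ S, IsFrac (Y ω) = IsFrac (Y ω'))
    (hkeeps : ∀ ω ∈ S, ω.1.Keeps (Y ω) (Y ω)) (hne : ∀ ω ∈ S, Z ω ≠ 0)
    (hallows : ∀ ω ∈ S, ω.1.Allows (Y ω) (Z ω) ∧ ω.1.Allows (Y ω) (-Z ω)) :
    Reaches registers S K (m * n + (maxStepTime m n s + maxStepTime m n s)) fun S' K' =>
      ∃ α ∈ K', ∃ β ∈ K', Knows K' (fun ω => Y ω + α ω • Z ω) ∧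
        Knows K' (fun ω => Y ω - β ω • Z ω) ∧
        ∀ ω ∈ S', ω.1.MaxStep (Y ω) (Z ω) (α ω) ∧ ω.1.MaxStep (Y ω) (-Z ω) (β ω) := by
  refine (reaches_knows_neg hK hZ).trans fun S₁ hS₁ _ K₁ hK₁ hnegZ => ?_
  refine (reaches_maxStep (hK.mono hK₁) (hY.mono hK₁) (hZ.mono hK₁)
    (fun ω hω ω' hω' => hfrac ω (hS₁ hω) ω' (hS₁ hω')) (fun ω hω => hkeeps ω (hS₁ hω))
    (fun ω hω => hne ω (hS₁ hω)) fun ω hω => (hallows ω (hS₁ hω)).1).trans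
      fun S₂ hS₂ _ K₂ hK₂ ⟨α, hα, hadd, hαmax⟩ => ?_
  have hS₀₂ : S₂ ⊆ S := hS₂.trans hS₁
  have hK₀₂ : K ⊆ K₂ := hK₁.trans hK₂
  refine (reaches_maxStep (hK.mono hK₀₂) (hY.mono hK₀₂) (hnegZ.mono hK₂)
    (fun ω hω ω' hω' => hfrac ω (hS₀₂ hω) ω' (hS₀₂ hω')) (fun ω hω => hkeeps ω (hS₀₂ hω))
    (fun ω hω => neg_ne_zero.2 (hne ω (hS₀₂ hω))) fun ω hω => (hallows ω (hS₀₂ hω)).2).mono le_rfl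
      fun S₃ hS₃ _ K₃ hK₃ ⟨β, hβ, hsub, hβmax⟩ => ?_
  simp only [smul_neg, ← sub_eq_add_neg] at hsub
  exact ⟨α, hK₃ hα, β, hβ, hadd.mono hK₃, hsub, fun ω hω => ⟨hαmax ω (hS₃ hω), hβmax ω hω⟩⟩

theorem one_le_registers_customer_iff (ω : RoundingInput m n s) (j : Fin n) (k : Fin s) :
    1 ≤ registers ω (.customer j k) ↔ ω.1.customer j = k := by
  simp only [registers, input]
  split_ifs with h <;> simp [h]

/-- The time to compare all variables with `0` and `1`, to determine the tight constraints, and to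
read off the customers. -/
def patternTime (m n s : ℕ) : ℕ :=
  Fintype.card (Row m n s) * (2 * (m * n)) + Fintype.card (Ineq m n s ⊕ Fin n × Fin s)

theorem reaches_pattern (hK : KnowsInput K) (hY : Knows K Y)
    (hkeeps : ∀ ω ∈ S, ω.1.Keeps (Y ω) (Y ω)) :
    Reaches registers S K (patternTime m n s) fun S' _ => ∀ ω ∈ S', ∀ ω' ∈ S',
      ω.1.pattern (Y ω) = ω'.1.pattern (Y ω') ∧ ∀ i j, 1 ≤ Y ω i j ↔ 1 ≤ Y ω' i j := by
  let smaller : Ineq m n s ⊕ Fin n × Fin s → RoundingInput m n s → ℝ :=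
    Sum.elim (Sum.elim (fun e ω => Y ω e.1 e.2) <| Sum.elim (fun _ _ => 1) fun v ω => ω.1.bound v)
      fun _ _ => 1
  let larger : Ineq m n s ⊕ Fin n × Fin s → RoundingInput m n s → ℝ :=
    Sum.elim (Sum.elim (fun _ _ => 0) <|
      Sum.elim (fun e ω => Y ω e.1 e.2) fun v ω => ω.1.load (Y ω) v)
      fun jk ω => registers ω (.customer jk.1 jk.2)
  refine (Reaches.cost_all (hY.cost_load hK)).trans fun S₁ hS₁ _ K₁ hK₁ hload => ?_
  have hsmaller : ∀ q, smaller q ∈ K₁ := by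
    rintro ((e | e | v) | jk)
    exacts [hK₁ (hY e.1 e.2), hK₁ hK.one, hK₁ (hK.bound_mem v), hK₁ hK.one]
  have hlarger : ∀ q, larger q ∈ K₁ := by
    rintro ((e | e | v) | jk)
    exacts [hK₁ hK.zero, hK₁ (hY e.1 e.2), hload v, hK₁ (hK.registers _)]
  refine (Reaches.compare_all hsmaller hlarger).mono le_rfl
    fun S₂ hS₂ _ K₂ _ hcompare ω hω ω' hω' => ?_
  replace hcompare := hcompare ω hω ω' hω'
  have hone : ∀ i j, 1 ≤ Y ω i j ↔ 1 ≤ Y ω' i j := fun i j => hcompare (.inl (.inr (.inl (i, j))))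
  have hcustomer : ∀ j k, ω.1.customer j = k ↔ ω'.1.customer j = k := fun j k => by
    rw [← one_le_registers_customer_iff, ← one_le_registers_customer_iff]
    exact hcompare (.inr (j, k))
  exact ⟨pattern_eq_of_comparisons (hkeeps ω (hS₁ (hS₂ hω))) (hkeeps ω' (hS₁ (hS₂ hω')))
    (fun i j => hcompare (.inl (.inl (i, j)))) hone (fun v => hcompare (.inl (.inr (.inr v))))
    (funext fun j => ((hcustomer j _).1 rfl).symm), hone⟩

theorem reaches_solves (hK : KnowsInput K) (hcard : C.card < F.card) :
    Reaches registers S K (C.card * eliminationTime (Row m n s) (Fin m × Fin n)) fun S' K' =>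
      ∃ Z, Knows K' Z ∧ ∀ ω ∈ S', ω.1.Solves F C (Z ω) := by
  refine (reaches_knowsKernelVector hcard hK.zero hK.one hK.coef_mem).mono le_rfl ?_
  rintro S' - - K' - ⟨z, hzK, hz⟩
  refine ⟨fun ω i j => z (i, j) ω, fun i j => hzK (i, j), fun ω hω => ⟨fun h0 => ?_, ?_, ?_⟩⟩
  · exact (hz ω hω).ne_zero (funext fun e => congrFun (congrFun h0 e.1) e.2)
  · exact (hz ω hω).support
  · intro v hv
    rw [load_eq_sum]
    exact (hz ω hω).sum_eq_zero v hv

theorem reaches_load_nonpos_or_neg (hK : KnowsInput K) (hZ : Knows K Z) (v : Row m n s) :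
    Reaches registers S K (2 * (m * n) + (1 + m * n)) fun S' K' =>
      ∃ Z', Knows K' Z' ∧ ∀ ω ∈ S', (Z' ω = Z ω ∨ Z' ω = -Z ω) ∧ ω.1.load (Z' ω) v ≤ 0 := by
  refine (Reaches.cost (hZ.cost_load hK v)).trans fun S₁ _ _ K₁ hK₁ hload => ?_
  refine (Reaches.compare hload (hK₁ hK.zero)).trans fun S₂ _ _ K₂ hK₂ hsign => ?_
  have hK₀₂ : K ⊆ K₂ := hK₁.trans hK₂
  refine (reaches_knows_neg (hK.mono hK₀₂) (hZ.mono hK₀₂)).mono le_rfl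
    fun S₃ hS₃ _ K₃ hK₃ hneg => ?_
  rcases hsign with hle | hlt
  · exact ⟨Z, hZ.mono (hK₀₂.trans hK₃), fun ω hω => ⟨.inl rfl, hle ω (hS₃ hω)⟩⟩
  · refine ⟨_, hneg, fun ω hω => ⟨.inr rfl, ?_⟩⟩
    rw [load_neg]
    exact neg_nonpos.2 (hlt ω (hS₃ hω)).le

/-- What the computation knows after it found a deterministic move from `Y`. -/
def KnowsDeterministicMove (Y : RoundingInput m n s → Frac m n) (S : Set (RoundingInput m n s))
    (K : Set (RoundingInput m n s → ℝ)) : Prop :=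
  ∃ Y', Knows K Y' ∧ ∀ ω ∈ S, ω.1.Move (Y ω) (PMF.pure (Y' ω))

/-- What the computation knows after it found a Rand-Move from `Y`. -/
def KnowsRandomMove (Y : RoundingInput m n s → Frac m n) (S : Set (RoundingInput m n s))
    (K : Set (RoundingInput m n s → ℝ)) : Prop :=
  ∃ p ∈ K, ∃ Y₁ Y₂, Knows K Y₁ ∧ Knows K Y₂ ∧ ∀ ω ∈ S, p ω ∈ Set.Ioo 0 1 ∧ Y₁ ω ≠ Y₂ ω ∧
    ω.1.Move (Y ω) (PMF.mix (p ω) (PMF.pure (Y₁ ω)) (PMF.pure (Y₂ ω)))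

theorem reaches_knowsDeterministicMove {P : Pattern m n s} (hK : KnowsInput K) (hY : Knows K Y)
    (hkeeps : ∀ ω ∈ S, ω.1.Keeps (Y ω) (Y ω)) (hP : ∀ ω ∈ S, ω.1.pattern (Y ω) = P)
    (hF : ∀ e ∈ F, P.frac e.1 e.2) (hcard : C.card < F.card)
    {v : Row m n s} (hplan : P.DeterministicPlan F C v) :
    Reaches registers S K (C.card * eliminationTime (Row m n s) (Fin m × Fin n) +
      (2 * (m * n) + (1 + m * n) + maxStepTime m n s)) (KnowsDeterministicMove Y) := by
  refine (reaches_solves hK hcard).trans fun S₁ hS₁ _ K₁ hK₁ ⟨Z, hZ, hsolves⟩ => ?_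
  refine (reaches_load_nonpos_or_neg (hK.mono hK₁) hZ v).trans
    fun S₂ hS₂ _ K₂ hK₂ ⟨Z', hZ', hsign⟩ => ?_
  have hS₀₂ : S₂ ⊆ S := hS₂.trans hS₁
  have hsolves' : ∀ ω ∈ S₂, ω.1.Solves F C (Z' ω) := fun ω hω => by
    rcases (hsign ω hω).1 with h | h
    · exact h ▸ hsolves ω (hS₂ hω)
    · exact h ▸ (hsolves ω (hS₂ hω)).neg
  have hfrac : ∀ ω ∈ S₂, IsFrac (Y ω) = P.frac := fun ω hω =>
    congrArg Pattern.frac (hP ω (hS₀₂ hω))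
  have hF' : ∀ ω ∈ S₂, ∀ e ∈ F, IsFrac (Y ω) e.1 e.2 := fun ω hω => hfrac ω hω ▸ hF
  have hplan' : ∀ ω ∈ S₂, (ω.1.pattern (Y ω)).DeterministicPlan F C v := fun ω hω =>
    hP ω (hS₀₂ hω) ▸ hplan
  refine (reaches_maxStep (hK.mono (hK₁.trans hK₂)) (hY.mono (hK₁.trans hK₂)) hZ'
    (fun ω hω ω' hω' => (hfrac ω hω).trans (hfrac ω' hω').symm) (fun ω hω => hkeeps ω (hS₀₂ hω))
    (fun ω hω => (hsolves' ω hω).ne_zero) fun ω hω => (hsolves' ω hω).allows_of_deterministicPlan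
      (hkeeps ω (hS₀₂ hω)) (hF' ω hω) (hplan' ω hω) (hsign ω hω).2).mono le_rfl ?_
  rintro S₃ hS₃ - K₃ - ⟨α, -, hnext, hmax⟩
  exact ⟨_, hnext, fun ω hω => (hsolves' ω (hS₃ hω)).move_of_deterministicPlan (hF' ω (hS₃ hω))
    (hplan' ω (hS₃ hω)) (hsign ω (hS₃ hω)).2 (hmax ω hω)⟩

theorem reaches_knowsRandomMove {P : Pattern m n s} (hK : KnowsInput K) (hY : Knows K Y)
    (hkeeps : ∀ ω ∈ S, ω.1.Keeps (Y ω) (Y ω)) (hP : ∀ ω ∈ S, ω.1.pattern (Y ω) = P)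
    (hF : ∀ e ∈ F, P.frac e.1 e.2) (hcard : C.card < F.card) (hplan : P.RandomPlan F C) :
    Reaches registers S K (C.card * eliminationTime (Row m n s) (Fin m × Fin n) +
      (m * n + (maxStepTime m n s + maxStepTime m n s) + 2)) (KnowsRandomMove Y) := by
  have hfrac : ∀ ω ∈ S, IsFrac (Y ω) = P.frac := fun ω hω => congrArg Pattern.frac (hP ω hω)
  have hF' : ∀ ω ∈ S, ∀ e ∈ F, IsFrac (Y ω) e.1 e.2 := fun ω hω => hfrac ω hω ▸ hF
  have hplan' : ∀ ω ∈ S, (ω.1.pattern (Y ω)).RandomPlan F C := fun ω hω => hP ω hω ▸ hplan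
  refine (reaches_solves hK hcard).trans fun S₁ hS₁ _ K₁ hK₁ ⟨Z, hZ, hsolves⟩ => ?_
  refine (reaches_maxStep_both (hK.mono hK₁) (hY.mono hK₁) hZ
    (fun ω hω ω' hω' => (hfrac ω (hS₁ hω)).trans (hfrac ω' (hS₁ hω')).symm)
    (fun ω hω => hkeeps ω (hS₁ hω)) (fun ω hω => (hsolves ω hω).ne_zero) fun ω hω =>
      ⟨(hsolves ω hω).allows_of_randomPlan (hkeeps ω (hS₁ hω)) (hF' ω (hS₁ hω)) (hplan' ω (hS₁ hω)),
        (hsolves ω hω).neg.allows_of_randomPlan (hkeeps ω (hS₁ hω)) (hF' ω (hS₁ hω))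
          (hplan' ω (hS₁ hω))⟩).trans
    fun S₂ hS₂ _ K₂ _ ⟨α, hα, β, hβ, hadd, hsub, hmax⟩ => ?_
  refine (Reaches.cost ((Cost.mem hβ).div ((Cost.mem hα).add (Cost.mem hβ)))).mono le_rfl
    fun S₃ hS₃ _ K₃ hK₃ hp => ⟨_, hp, _, _, hadd.mono hK₃, hsub.mono hK₃, fun ω hω => ?_⟩
  obtain ⟨hαmax, hβmax⟩ := hmax ω (hS₃ hω)
  have hS : ω ∈ S := hS₁ (hS₂ (hS₃ hω))
  have hsolves := hsolves ω (hS₂ (hS₃ hω))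
  exact ⟨div_add_mem_Ioo hαmax.1 hβmax.1,
    add_smul_ne_sub_smul (add_pos hαmax.1 hβmax.1).ne' hsolves.ne_zero,
    hsolves.move_of_randomPlan (hF' ω hS) (hplan' ω hS) hαmax hβmax⟩

/-- From every known solution of potential below `p`, time `t` suffices to complete the rounding. -/
def RoundsWithin (m n s p t : ℕ) : Prop :=
  ∀ (S : Set (RoundingInput m n s)) (K : Set (RoundingInput m n s → ℝ))
    (Y : RoundingInput m n s → Frac m n), KnowsInput K → Knows K Y →
    (∀ ω ∈ S, ω.1.Keeps (Y ω) (Y ω) ∧ ω.1.potential (Y ω) < p) →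
    Solvable registers S K t fun ω D => ω.1.Rounds (Y ω) D

theorem RoundsWithin.solvable_of_step {p t : ℕ} (h : RoundsWithin m n s p t) (hK : KnowsInput K)
    {Y' : RoundingInput m n s → Frac m n} (hY' : Knows K Y')
    (hpot : ∀ ω ∈ S, ω.1.potential (Y ω) < p + 1) (hstep : ∀ ω ∈ S, ω.1.Step (Y ω) (Y' ω)) :
    Solvable registers S K t fun ω D => ω.1.Rounds (Y' ω) D :=
  h S K Y' hK hY' fun ω hω => ⟨(hstep ω hω).keeps_self,
    (hstep ω hω).potential_lt.trans_le (Nat.lt_succ_iff.1 (hpot ω hω))⟩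

theorem KnowsDeterministicMove.solvable {p t : ℕ} (h : KnowsDeterministicMove Y S K)
    (hrec : RoundsWithin m n s p t) (hK : KnowsInput K)
    (hpot : ∀ ω ∈ S, ω.1.potential (Y ω) < p + 1) :
    Solvable registers S K t fun ω D => ω.1.Rounds (Y ω) D := by
  obtain ⟨Y', hY', hmove⟩ := h
  exact (hrec.solvable_of_step hK hY' hpot fun ω hω => ⟨_, hmove ω hω, by simp⟩).mono_goal
    fun ω hω D hD => .of_pure (hmove ω hω) hD

theorem KnowsRandomMove.solvable {p t : ℕ} (h : KnowsRandomMove Y S K)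
    (hrec : RoundsWithin m n s p t) (hK : KnowsInput K)
    (hpot : ∀ ω ∈ S, ω.1.potential (Y ω) < p + 1) :
    Solvable registers S K (t + 1) fun ω D => ω.1.Rounds (Y ω) D := by
  obtain ⟨b, hb, Y₁, Y₂, hY₁, hY₂, hmove⟩ := h
  refine .coin hb
    (hrec.solvable_of_step hK hY₁ hpot fun ω hω => ⟨_, (hmove ω hω).2.2,
      mem_support_mix_left (hmove ω hω).1.1 (by simp)⟩)
    (hrec.solvable_of_step hK hY₂ hpot fun ω hω => ⟨_, (hmove ω hω).2.2,
      mem_support_mix_right (hmove ω hω).1.2 (by simp)⟩)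
    fun ω hω D₁ D₂ h₁ h₂ => .of_mix (hmove ω hω).2.2 (hmove ω hω).2.1 h₁ h₂

theorem solvable_of_rounded {t : ℕ}
    (hone : ∀ ω ∈ S, ∀ ω' ∈ S, ∀ i j, 1 ≤ Y ω i j ↔ 1 ≤ Y ω' i j)
    (hrounded : ∀ ω ∈ S, Rounded (Y ω)) :
    Solvable registers S K t fun ω D => ω.1.Rounds (Y ω) D := by
  classical
  refine .of_nonempty fun ⟨ω₀, hω₀⟩ => ?_
  let X : Alloc m n := fun i j => decide (1 ≤ Y ω₀ i j)
  refine .output X fun ω hω => ?_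
  have hX : Y ω = X.toFrac := by
    ext i j
    simp only [Alloc.toFrac, X, decide_eq_true_eq, ← hone ω hω ω₀ hω₀]
    rcases hrounded ω hω i j with h | h <;> simp [h]
  rw [hX]
  exact .done X

/-- The time to find a move for a given pattern and to toss its coin. -/
def planTime (m n s : ℕ) : ℕ :=
  Fintype.card (Row m n s) * eliminationTime (Row m n s) (Fin m × Fin n) +
    3 * (m * n) + 2 * maxStepTime m n s + 3

/-- The time for one move. -/
def moveTime (m n s : ℕ) : ℕ := planTime m n s + patternTime m n s

theorem RoundsWithin.solvable_of_plan {p t : ℕ} (hrec : RoundsWithin m n s p t) {P : Pattern m n s}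
    (hK : KnowsInput K) (hY : Knows K Y) (hkeeps : ∀ ω ∈ S, ω.1.Keeps (Y ω) (Y ω))
    (hpot : ∀ ω ∈ S, ω.1.potential (Y ω) < p + 1) (hP : ∀ ω ∈ S, ω.1.pattern (Y ω) = P)
    (hplan : P.Plan F C) :
    Solvable registers S K (t + planTime m n s) fun ω D => ω.1.Rounds (Y ω) D := by
  have hC : C.card * eliminationTime (Row m n s) (Fin m × Fin n) ≤
      Fintype.card (Row m n s) * eliminationTime (Row m n s) (Fin m × Fin n) :=
    Nat.mul_le_mul_right _ (Finset.card_le_univ C)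
  rcases hplan.move with ⟨v, hdet⟩ | hrand
  · refine (reaches_knowsDeterministicMove hK hY hkeeps hP hplan.frac hplan.card_lt hdet _ t _
      fun S' hS' _ K' hK' hmove => ?_).mono_time (by unfold planTime; omega)
    exact hmove.solvable hrec (hK.mono hK') fun ω hω => hpot ω (hS' hω)
  · refine (reaches_knowsRandomMove hK hY hkeeps hP hplan.frac hplan.card_lt hrand _ (t + 1) _
      fun S' hS' _ K' hK' hmove => ?_).mono_time (by unfold planTime; omega)
    exact hmove.solvable hrec (hK.mono hK') fun ω hω => hpot ω (hS' hω)

theorem RoundsWithin.succ {p t : ℕ} (hrec : RoundsWithin m n s p t) :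
    RoundsWithin m n s (p + 1) (t + moveTime m n s) := by
  intro S K Y hK hY hS
  have hkeeps : ∀ ω ∈ S, ω.1.Keeps (Y ω) (Y ω) := fun ω hω => (hS ω hω).1
  refine (reaches_pattern hK hY hkeeps _ (t + planTime m n s) _
    fun S' hS' ⟨ω₀, hω₀⟩ K' hK' hpattern => ?_).mono_time (add_assoc ..).le
  have hP : ∀ ω ∈ S', ω.1.pattern (Y ω) = ω₀.1.pattern (Y ω₀) := fun ω hω =>
    (hpattern ω hω ω₀ hω₀).1
  have hkeeps' : ∀ ω ∈ S', ω.1.Keeps (Y ω) (Y ω) := fun ω hω => hkeeps ω (hS' hω)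
  by_cases hrounded : Rounded (Y ω₀)
  · refine solvable_of_rounded (fun ω hω ω' hω' => (hpattern ω hω ω' hω').2) fun ω hω i j =>
      (hkeeps' ω hω).1.eq_zero_or_eq_one ?_
    rw [show IsFrac (Y ω) = IsFrac (Y ω₀) from congrArg Pattern.frac (hP ω hω)]
    exact hrounded.not_isFrac i j
  · obtain ⟨F, C, hplan⟩ := (hkeeps' ω₀ hω₀).exists_plan hrounded
    exact hrec.solvable_of_plan (hK.mono hK') (hY.mono hK') hkeeps'
      (fun ω hω => (hS ω (hS' hω)).2) hP hplan

theorem roundsWithin (p : ℕ) : RoundsWithin m n s p (p * moveTime m n s) := by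
  induction p with
  | zero =>
    exact fun S K Y _ _ hS =>
      .output (fun _ _ => false) fun ω hω => absurd (hS ω hω).2 (Nat.not_lt_zero _)
  | succ p ih =>
    rw [Nat.succ_mul]
    exact ih.succ

theorem reaches_knowsInput :
    Reaches registers S K 2 fun _ K' => KnowsInput K' := by
  refine (Reaches.inputs.trans fun S₁ _ _ K₁ _ hinput => ?_ : Reaches registers S K (0 + 2) _)
  refine Reaches.one.trans (d := 1) fun S₂ _ _ K₂ hK₂ hone => ?_
  refine (Reaches.cost ((Cost.mem hone).sub (Cost.mem hone))).mono le_rfl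
    fun S₃ _ _ K₃ hK₃ hzero => ?_
  exact ⟨by simpa only [sub_self] using hzero, hK₃ hone, fun r => hK₃ (hK₂ (hinput r))⟩

/-- A bound on the number of moves. -/
def maxMoves (m n s : ℕ) : ℕ := (m * n + 1) * ((n + 1) * (m + n + s + 1))

theorem exists_compTree_rounds (m n s : ℕ) :
    ∃ T : CompTree (InputReg m n s) (Alloc m n), T.time ≤ maxMoves m n s * moveTime m n s + 2 ∧
      ∀ (I : AdCell m n s) (y : Frac m n), I.Keeps y y → I.Rounds y (T.run (I.input y)) := by
  have hsolvable : Solvable registers {ω : RoundingInput m n s | ω.1.Keeps ω.2 ω.2} ∅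
      (maxMoves m n s * moveTime m n s + 2) fun ω D => ω.1.Rounds ω.2 D :=
    reaches_knowsInput _ _ _ fun S hS _ K _ hK => roundsWithin (maxMoves m n s) S K Prod.snd hK
      (fun i j => hK.registers (.sol i j)) fun ω hω => ⟨hS hω, ω.1.potential_lt ω.2⟩
  obtain ⟨T, hT, hrounds⟩ := hsolvable (fun _ _ => 0) 0 (by simp)
  exact ⟨T, hT, fun I y hy => hrounds (I, y) hy⟩

theorem Keeps.exists_move {I : AdCell m n s} {y : Frac m n} (hy : I.Keeps y y)
    (hr : ¬ Rounded y) : ∃ μ, I.Move y μ := by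
  obtain ⟨D, hD⟩ : ∃ D, I.Rounds y D :=
    let ⟨T, _, hT⟩ := exists_compTree_rounds m n s
    ⟨_, hT I y hy⟩
  cases hD with
  | done X => exact absurd (toFrac_eq_zero_or_eq_one X) hr
  | move _ μ _ hμ _ => exact ⟨μ, hμ⟩

end AdCell

/-! ### Polynomial bounds -/

namespace AdCell

theorem maxMoves_le (m n s : ℕ) : maxMoves m n s ≤ 2 * (m + n + s + 1) ^ 4 := by
  have hmn : m * n ≤ (m + n + s + 1) ^ 2 := by rw [sq]; gcongr <;> omega
  have hn : n + 1 ≤ m + n + s + 1 := by omega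
  unfold maxMoves
  generalize m + n + s + 1 = M at *
  have hM : 1 ≤ M ^ 2 := Nat.one_le_pow _ _ (by omega)
  calc (m * n + 1) * ((n + 1) * M) ≤ (M ^ 2 + M ^ 2) * (M * M) := by gcongr
    _ = 2 * M ^ 4 := by ring

theorem moveTime_le (m n s : ℕ) : moveTime m n s ≤ 100 * (m + n + s + 1) ^ 4 := by
  have hmn : m * n ≤ (m + n + s + 1) ^ 2 := by rw [sq]; gcongr <;> omega
  have hns : n * s ≤ (m + n + s + 1) ^ 2 := by rw [sq]; gcongr <;> omega
  have hrow : m + (n + s) ≤ m + n + s + 1 := by omega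
  have hM : 1 ≤ m + n + s + 1 := by omega
  simp only [moveTime, planTime, patternTime, maxStepTime, CompTree.eliminationTime, Row, Ineq,
    Fintype.card_sum, Fintype.card_prod, Fintype.card_fin]
  generalize m + n + s + 1 = M at *
  generalize m * n = a at *
  generalize n * s = b at *
  generalize m + (n + s) = c at *
  grw [hmn, hns, hrow]
  have hM₁ : M ≤ M ^ 4 := by simpa using Nat.pow_le_pow_right hM (show 1 ≤ 4 by norm_num)
  have hM₂ : M ^ 2 ≤ M ^ 4 := Nat.pow_le_pow_right hM (by norm_num)
  have hM₃ : M ^ 3 ≤ M ^ 4 := Nat.pow_le_pow_right hM (by norm_num)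
  ring_nf
  omega

theorem maxMoves_mul_moveTime_le (m n s : ℕ) :
    maxMoves m n s * moveTime m n s + 2 ≤ 202 * (m + n + s + 1) ^ 8 := by
  have hpos : 1 ≤ (m + n + s + 1) ^ 8 := Nat.one_le_pow _ _ (by omega)
  calc maxMoves m n s * moveTime m n s + 2
      ≤ 2 * (m + n + s + 1) ^ 4 * (100 * (m + n + s + 1) ^ 4) + 2 * (m + n + s + 1) ^ 8 := by
        gcongr
        exacts [maxMoves_le m n s, moveTime_le m n s, by omega]
    _ = 202 * (m + n + s + 1) ^ 8 := by ring

end AdCell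

theorem mainTheorem4_general :
    ∃ C : ℕ, ∀ m n s : ℕ,
      (∀ (I : AdCell m n s) (y : Frac m n), I.LPFeasible y →
        (∀ (N : ℕ) (path : ℕ → Frac m n), path 0 = y →
          (∀ t < N, I.Step (path t) (path (t + 1))) → N ≤ C * (m + n + s + 1) ^ C) ∧
        (∀ y' : Frac m n, Relation.ReflTransGen I.Step y y' → ¬ AdCell.Rounded y' →
          ∃ μ, I.Move y' μ) ∧
        (∀ D : PMF (Alloc m n), I.Rounds y D →
          (∀ X ∈ D.support, I.Feasible X) ∧
          (4 - I.maxBidRatio) / 4 * I.lpValue y ≤ D.expect I.revenue ∧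
          ((∀ i j, I.bid i j ≤ I.budget i) → 3 / 4 * I.lpValue y ≤ D.expect I.revenue) ∧
          (∀ ε : ℝ, (∀ i j, I.bid i j ≤ ε * I.budget i) →
            (4 - ε) / 4 * I.lpValue y ≤ D.expect I.revenue))) ∧
      (∀ (I : AdCell m n s) (y : Frac m n), I.truncate.LPFeasible y →
        ∀ D : PMF (Alloc m n), I.truncate.Rounds y D →
          (∀ X ∈ D.support, I.Feasible X) ∧
          3 / 4 * I.truncate.lpValue y ≤ D.expect I.revenue) ∧
      (∃ T : CompTree (InputReg m n s) (Alloc m n), T.time ≤ C * (m + n + s + 1) ^ C ∧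
        ∀ (I : AdCell m n s) (y : Frac m n), I.LPFeasible y →
          I.Rounds y (T.run (I.input y))) := by
  refine ⟨202, fun m n s => ?_⟩
  have hpoly : ∀ k ≤ 202, ∀ d ≤ 202,
      k * (m + n + s + 1) ^ d ≤ 202 * (m + n + s + 1) ^ 202 := fun k hk d hd =>
    Nat.mul_le_mul hk (Nat.pow_le_pow_right (by omega) hd)
  refine ⟨fun I y hy => ⟨?_, fun y' hy' => (hy.keeps.of_reachable hy').exists_move, fun D hD =>
      ⟨fun X => hD.feasible hy.keeps, hD.mul_lpValue_le_expect_revenue hy I.bid_le_maxBidRatio_mul,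
        hD.three_fourths_lpValue_le_expect_revenue hy,
        fun ε => hD.mul_lpValue_le_expect_revenue hy⟩⟩,
    fun I y hy D hD => ⟨fun X => hD.feasible hy.keeps, ?_⟩, ?_⟩
  · rintro N path rfl hsteps
    calc N ≤ I.potential (path 0) := I.le_potential_of_steps hsteps
      _ ≤ AdCell.maxMoves m n s := (I.potential_lt _).le
      _ ≤ 2 * (m + n + s + 1) ^ 4 := AdCell.maxMoves_le m n s
      _ ≤ _ := hpoly 2 (by norm_num) 4 (by norm_num)
  · rw [← I.truncate_revenue]
    exact hD.three_fourths_lpValue_le_expect_revenue hy fun i j => min_le_right _ _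
  · obtain ⟨T, hT, hrounds⟩ := AdCell.exists_compTree_rounds m n s
    exact ⟨T, hT.trans <| (AdCell.maxMoves_mul_moveTime_le m n s).trans <|
      hpoly 202 le_rfl 8 (by norm_num), fun I y hy => hrounds I y hy.keeps⟩

theorem mainTheorem4 :
    ∃ C : ℕ, ∀ m n s : ℕ,
      -- every execution of the rounding, from any optimal solution of the linear program
      (∀ (I : AdCell m n s) (y : Frac m n), I.IsLPOptimal y →
        -- it stops after polynomially many iterations, and not before all variables are rounded
        (∀ (N : ℕ) (path : ℕ → Frac m n), path 0 = y →
          (∀ t < N, I.Step (path t) (path (t + 1))) → N ≤ C * (m + n + s + 1) ^ C) ∧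
        (∀ y' : Frac m n, Relation.ReflTransGen I.Step y y' → ¬ AdCell.Rounded y' →
          ∃ μ, I.Move y' μ) ∧
        -- the allocation found
        (∀ D : PMF (Alloc m n), I.Rounds y D →
          (∀ X ∈ D.support, I.Feasible X) ∧
          (4 - I.maxBidRatio) / 4 * I.lpOpt ≤ D.expect I.revenue ∧
          ((∀ i j, I.bid i j ≤ I.budget i) → 3 / 4 * I.lpOpt ≤ D.expect I.revenue) ∧
          (∀ ε : ℝ, (∀ i j, I.bid i j ≤ ε * I.budget i) →
            (4 - ε) / 4 * I.lpOpt ≤ D.expect I.revenue))) ∧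
      -- the optimum of the linear program bounds the revenue of every feasible allocation
      (∀ (I : AdCell m n s) (X : Alloc m n), I.Feasible X → I.revenue X ≤ I.lpOpt) ∧
      -- bids above the budgets: round for the truncated bids
      (∀ (I : AdCell m n s) (y : Frac m n), I.truncate.IsLPOptimal y →
        ∀ D : PMF (Alloc m n), I.truncate.Rounds y D →
          (∀ X ∈ D.support, I.Feasible X) ∧
          3 / 4 * I.truncate.lpOpt ≤ D.expect I.revenue ∧
          (∀ X, I.Feasible X → 3 / 4 * I.revenue X ≤ D.expect I.revenue)) ∧
      -- the rounding runs in polynomial time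
      (∃ T : CompTree (InputReg m n s) (Alloc m n), T.time ≤ C * (m + n + s + 1) ^ C ∧
        ∀ (I : AdCell m n s) (y : Frac m n), I.IsLPOptimal y →
          I.Rounds y (T.run (I.input y))) := by
  obtain ⟨C, hC⟩ := mainTheorem4_general
  refine ⟨C, fun m n s => ?_⟩
  obtain ⟨hround, htruncate, T, hT, hrounds⟩ := hC m n s
  refine ⟨fun I y hy => hy.lpOpt_eq ▸ hround I y hy.1, fun I X hX => hX.revenue_le_lpOpt,
    fun I y hy D hD => ?_, T, hT, fun I y hy => hrounds I y hy.1⟩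
  obtain ⟨hfeasible, hrevenue⟩ := hy.lpOpt_eq ▸ htruncate I y hy.1 D hD
  refine ⟨hfeasible, hrevenue, fun X hX => le_trans ?_ hrevenue⟩
  gcongr
  exact hX.revenue_le_lpOpt_truncate
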